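/- Let $0<s<1$, $1\le p<\infty$ and $n\ge 1$. For an open set $\Omega\subseteq\mathbb{R}^n$ and a measurable $u:\Omega\to\mathbb{R}$ put $$[u]_{s,p,\Omega}^p:=\frac{C_{n,s,p}}{2}\int_\Omega\int_\Omega\frac{|u(x)-u(y)|^p}{|x-y|^{n+sp}}\,dx\,dy,\qquad C_{n,s,p}:=\frac{sp\,2^{2s-1}\,\Gamma\left(\frac{n+sp}{2}\right)}{2\pi^{\frac{n-1}{2}}\,\Gamma(1-s)\,\Gamma\left(\frac{p+1}{2}\right)}.$$ Let $W^{s,p}(\Omega)$ be the space of all $u\in L^p(\Omega)$ with $[u]_{s,p,\Omega}<\infty$, let $W^{s,p}_0(\Omega)$ be the closure of $C_c^\infty(\Omega)$ in $W^{s,p}(\Omega)$ for the norm $\big(\|u\|_{L^p(\Omega)}^p+[u]_{s,p,\Omega}^p\big)^{1/p}$, and define the regional fractional Poincaré constant $$P^1_{n,s,p}(\Omega):=\inf_{u\in W^{s,p}_0(\Omega),\ u\neq 0}\ \frac{[u]_{s,p,\Omega}^p}{\int_\Omega|u|^p\,dx}.$$ Let $\Omega_\infty:=(-1,1)\times\mathbb{R}^{n-1}\subset\mathbb{R}^n$.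 Then the following hold. 1. If $0<s\le \frac1p$, then $P^1_{n,s,p}(\Omega_\infty)=P^1_{1,s,p}((-1,1))=0$. 2. For all $0<s<1$, $P^1_{n,s,p}(\Omega_\infty)=P^1_{1,s,p}((-1,1))<\infty$. Moreover, $P^1_{n,s,p}(\Omega_\infty)>0$ if $\frac1p<s<1$. -/

import Mathlib

open MeasureTheory
open scoped ENNReal

noncomputable section

namespace FracPoincare

/-- The normalisation constant `C_{n,s,p}` of the Gagliardo seminorm. -/
def normConst (n : ℕ) (s p : ℝ) : ℝ :=
  (s * p * 2 ^ (2 * s - 1) * Real.Gamma ((n + s * p) / 2)) /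
    (2 * Real.pi ^ (((n : ℝ) - 1) / 2) * Real.Gamma (1 - s) * Real.Gamma ((p + 1) / 2))

section

variable {E : Type*} [NormedAddCommGroup E] [NormedSpace ℝ E] [MeasureSpace E]

/-- The Gagliardo seminorm `[u]_{s,p,Ω}` on a subset `Ω` of a Euclidean space `E` of dimension
`n = finrank ℝ E`, as an extended nonnegative number. -/
def seminorm (s p : ℝ) (Ω : Set E) (u : E → ℝ) : ℝ≥0∞ :=
  (ENNReal.ofReal (normConst (Module.finrank ℝ E) s p / 2) *
    ∫⁻ x in Ω, ∫⁻ y in Ω,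
      ENNReal.ofReal (|u x - u y| ^ p / ‖x - y‖ ^ ((Module.finrank ℝ E : ℝ) + s * p))) ^ (1 / p)

/-- `∫_Ω |u|^p`, as an extended nonnegative number. -/
def lpIntegral (p : ℝ) (Ω : Set E) (u : E → ℝ) : ℝ≥0∞ :=
  ∫⁻ x in Ω, ENNReal.ofReal (|u x| ^ p)

/-- The fractional Sobolev norm `‖u‖_{s,p,Ω}`. -/
def sobolevNorm (s p : ℝ) (Ω : Set E) (u : E → ℝ) : ℝ≥0∞ :=
  (lpIntegral p Ω u + seminorm s p Ω u ^ p) ^ (1 / p)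

/-- `u` represents an element of `W^{s,p}(Ω)`; only its values on `Ω` matter. -/
def MemW (s p : ℝ) (Ω : Set E) (u : E → ℝ) : Prop :=
  MemLp u (ENNReal.ofReal p) (volume.restrict Ω) ∧ seminorm s p Ω u < ⊤

/-- `φ ∈ C_c^∞(Ω)`. -/
def IsTest (Ω : Set E) (φ : E → ℝ) : Prop :=
  ContDiff ℝ (⊤ : ℕ∞) φ ∧ HasCompactSupport φ ∧ tsupport φ ⊆ Ω

/-- `u ∈ W_0^{s,p}(Ω)`, the closure of `C_c^∞(Ω)` in `W^{s,p}(Ω)`. -/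
def MemW0 (s p : ℝ) (Ω : Set E) (u : E → ℝ) : Prop :=
  MemW s p Ω u ∧
    ∀ ε : ℝ≥0∞, 0 < ε → ∃ φ : E → ℝ, IsTest Ω φ ∧ sobolevNorm s p Ω (fun x => u x - φ x) < ε

/-- The regional fractional Poincaré constant `P¹_{n,s,p}(Ω)`, `n = finrank ℝ E`: the infimum of
`[u]_{s,p,Ω}^p / ∫_Ω |u|^p` over all `u ∈ W_0^{s,p}(Ω)` that are not a.e. zero on `Ω`. -/
def regionalConst (s p : ℝ) (Ω : Set E) : ℝ≥0∞ :=
  ⨅ (u : E → ℝ) (_ : MemW0 s p Ω u) (_ : ¬ u =ᵐ[volume.restrict Ω] 0),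
    seminorm s p Ω u ^ p / lpIntegral p Ω u

end

/-- The strip `(-1,1) × ℝ^{n-1}` in `ℝ^n`. -/
def strip (n : ℕ) (hn : 1 ≤ n) : Set (EuclideanSpace ℝ (Fin n)) :=
  {x | x ⟨0, hn⟩ ∈ Set.Ioo (-1 : ℝ) 1}

end FracPoincare

end

namespace FracPoincare

open Filter Topology

/-! ### Elementary inequalities -/

/-! Write σ = sp and n = m + 1. Almost every pair of points of the strip lies on a unique line t ↦
(t, a + tz), with z ∈ ℝ^m the slope. In these coordinates the energy on the strip becomes the
integral over (z, a), with weight (1 + |z|²)^(-(n+σ)/2), of the one-dimensional energies of the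
slices (`energy_strip`). The normalising constant is such that the total weight turns C_{n,s,p} into
C_{1,s,p} (`normConst_mul_lintegral_sliceWeight`). Hence the interval inequality, applied on each
slice and integrated, gives the strip constant at least the interval constant
(`regionalConst_Ioo_le_strip`).

For the converse, an interval profile is multiplied by a cutoff at scale R in the unbounded
directions. Relative to the cutoff mass, the energy is that of the profile plus O(R^(-q)), up to a
factor tending to 1 (`exists_energy_stripTest_le`); letting R → ∞ gives
`regionalConst_strip_mul_lpIntegral_le`.

The rest is one-dimensional. If σ > 1, a Hardy inequality at one endpoint, proved by absorption
(`hardyMass_le`), makes the constant positive. If σ ≤ 1, logarithmic cutoffs approximate the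
constant 1, whose regional energy is zero, by test functions of vanishing energy
(`regionalConst_Ioo_eq_zero`).

All of this is done on test functions; `mul_lpIntegral_le_of_test` passes to the closure. Triangle
inequalities are used for p-th powers, with weights θ^(1-p) and (1-θ)^(1-p) in place of Minkowski.
-/

/-- Convexity of t ↦ t^p at a/θ and b/(1-θ). As θ → 1 the coefficient of a^p tends to 1, so a main
term loses nothing while an error term only pays a constant. -/
lemma add_rpow_le_weighted {p θ a b : ℝ} (hp : 1 ≤ p) (h0 : 0 < θ) (h1 : θ < 1)
    (ha : 0 ≤ a) (hb : 0 ≤ b) :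
    (a + b) ^ p ≤ θ ^ (1 - p) * a ^ p + (1 - θ) ^ (1 - p) * b ^ p := by
  have h2 : 0 < 1 - θ := by linarith
  have key : ∀ {t c : ℝ}, 0 < t → 0 ≤ c → t * (c / t) ^ p = t ^ (1 - p) * c ^ p := by
    intro t c ht hc
    rw [Real.div_rpow hc ht.le, Real.rpow_sub ht, Real.rpow_one]
    field_simp
  have h := (convexOn_rpow hp).2 (x := a / θ) (y := b / (1 - θ))
    (Set.mem_Ici.2 (by positivity)) (Set.mem_Ici.2 (by positivity)) h0.le h2.le (by ring)
  simp only [smul_eq_mul] at h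
  rw [key h0 ha, key h2 hb, mul_div_cancel₀ _ h0.ne', mul_div_cancel₀ _ h2.ne'] at h
  exact h

lemma ofReal_rpow_div_le {p θ a b c k : ℝ} (hp : 1 ≤ p) (h0 : 0 < θ) (h1 : θ < 1)
    (h : |a| ≤ |b| + |c|) (hk : 0 ≤ k) :
    ENNReal.ofReal (|a| ^ p / k) ≤
      ENNReal.ofReal (θ ^ (1 - p)) * ENNReal.ofReal (|b| ^ p / k) +
        ENNReal.ofReal ((1 - θ) ^ (1 - p)) * ENNReal.ofReal (|c| ^ p / k) := by
  have h2 : 0 < 1 - θ := by linarith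
  rw [← ENNReal.ofReal_mul (by positivity), ← ENNReal.ofReal_mul (by positivity),
    ← ENNReal.ofReal_add (by positivity) (by positivity)]
  apply ENNReal.ofReal_le_ofReal
  have h3 : |a| ^ p ≤ (|b| + |c|) ^ p :=
    Real.rpow_le_rpow (abs_nonneg _) h (by linarith)
  have h4 := h3.trans (add_rpow_le_weighted hp h0 h1 (abs_nonneg b) (abs_nonneg c))
  calc |a| ^ p / k ≤ (θ ^ (1 - p) * |b| ^ p + (1 - θ) ^ (1 - p) * |c| ^ p) / k := by gcongr
    _ = _ := by ring

lemma le_of_forall_weight_mul_le {p : ℝ} {X Y : ℝ≥0∞}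
    (h : ∀ θ : ℝ, 0 < θ → θ < 1 → X ≤ ENNReal.ofReal (θ ^ (1 - p)) * Y) : X ≤ Y := by
  have h1 : Tendsto (fun θ : ℝ => ENNReal.ofReal (θ ^ (1 - p)) * Y) (𝓝[<] 1) (𝓝 (1 * Y)) := by
    apply ENNReal.Tendsto.mul_const _ (Or.inl one_ne_zero)
    have h2 : Tendsto (fun θ : ℝ => θ ^ (1 - p)) (𝓝 1) (𝓝 (1 ^ (1 - p))) :=
      (Real.continuousAt_rpow_const 1 (1 - p) (Or.inl one_ne_zero))
    rw [Real.one_rpow] at h2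
    have := ENNReal.tendsto_ofReal (h2.mono_left (nhdsWithin_le_nhds (s := Set.Iio 1)))
    simpa using this
  rw [one_mul] at h1
  refine ge_of_tendsto h1 ?_
  filter_upwards [Ioo_mem_nhdsLT (show (0 : ℝ) < 1 by norm_num)] with θ hθ
  exact h θ hθ.1 hθ.2

lemma le_of_forall_pos_le_add_mul {X Y C : ℝ≥0∞} (hC : C ≠ ⊤)
    (h : ∀ δ : ℝ≥0∞, 0 < δ → X ≤ Y + C * δ) : X ≤ Y := by
  have h1 : Tendsto (fun n : ℕ => Y + C * (n : ℝ≥0∞)⁻¹) atTop (𝓝 (Y + C * 0)) :=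
    tendsto_const_nhds.add
      (ENNReal.Tendsto.const_mul ENNReal.tendsto_inv_nat_nhds_zero (Or.inr hC))
  rw [mul_zero, add_zero] at h1
  exact ge_of_tendsto' h1 fun n => h _ (by simp)

/-! ### The energy -/

lemma normConst_pos {n : ℕ} {s p : ℝ} (hs0 : 0 < s) (hs1 : s < 1) (hp : 1 ≤ p) :
    0 < normConst n s p := by
  unfold normConst
  have h1 : 0 < Real.Gamma (((n : ℝ) + s * p) / 2) := Real.Gamma_pos_of_pos (by positivity)
  have h2 : 0 < Real.Gamma (1 - s) := Real.Gamma_pos_of_pos (by linarith)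
  have h3 : 0 < Real.Gamma ((p + 1) / 2) := Real.Gamma_pos_of_pos (by linarith)
  have := Real.pi_pos
  positivity

section

variable {E : Type*} [MeasureSpace E]

lemma lpIntegral_congr_ae {p : ℝ} {Ω : Set E} {u v : E → ℝ} (h : u =ᵐ[volume.restrict Ω] v) :
    lpIntegral p Ω u = lpIntegral p Ω v := by
  unfold lpIntegral
  refine lintegral_congr_ae ?_
  filter_upwards [h] with x hx
  rw [hx]

lemma lpIntegral_ne_top {p : ℝ} (hp : 1 ≤ p) {Ω : Set E}
    {u : E → ℝ} (hu : MemLp u (ENNReal.ofReal p) (volume.restrict Ω)) :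
    lpIntegral p Ω u ≠ ⊤ := by
  have h := lintegral_rpow_enorm_lt_top_of_eLpNorm_lt_top (f := u) (μ := volume.restrict Ω)
    (p := ENNReal.ofReal p) (by simp; linarith) ENNReal.ofReal_ne_top hu.2
  rw [ENNReal.toReal_ofReal (by linarith)] at h
  unfold lpIntegral
  refine ne_of_lt (lt_of_le_of_lt (lintegral_mono fun x => ?_) h)
  rw [Real.enorm_eq_ofReal_abs, ENNReal.ofReal_rpow_of_nonneg (abs_nonneg _) (by linarith)]

variable [NormedAddCommGroup E]

/-- The unnormalised Gagliardo double integral with kernel `‖x - y‖ ^ (-α)`. -/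
noncomputable def energy (p α : ℝ) (Ω : Set E) (u : E → ℝ) : ℝ≥0∞ :=
  ∫⁻ x in Ω, ∫⁻ y in Ω, ENNReal.ofReal (|u x - u y| ^ p / ‖x - y‖ ^ α)

lemma energy_congr_ae {p α : ℝ} {Ω : Set E} {u v : E → ℝ} (h : u =ᵐ[volume.restrict Ω] v) :
    energy p α Ω u = energy p α Ω v := by
  unfold energy
  refine lintegral_congr_ae ?_
  filter_upwards [h] with x hx
  refine lintegral_congr_ae ?_
  filter_upwards [h] with y hy
  rw [hx, hy]

lemma lpIntegral_le_weighted [OpensMeasurableSpace E] {p θ : ℝ} (hp : 1 ≤ p) (h0 : 0 < θ)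
    (h1 : θ < 1) {Ω : Set E} {u v w : E → ℝ} (hv : Measurable v)
    (h : ∀ x, |u x| ≤ |v x| + |w x|) :
    lpIntegral p Ω u ≤ ENNReal.ofReal (θ ^ (1 - p)) * lpIntegral p Ω v +
      ENNReal.ofReal ((1 - θ) ^ (1 - p)) * lpIntegral p Ω w := by
  unfold lpIntegral
  rw [← lintegral_const_mul' _ _ ENNReal.ofReal_ne_top,
    ← lintegral_const_mul' _ _ ENNReal.ofReal_ne_top, ← lintegral_add_left (by fun_prop)]
  refine lintegral_mono fun x => ?_
  simpa using ofReal_rpow_div_le hp h0 h1 (h x) zero_le_one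

lemma lpIntegral_eq_zero_iff [OpensMeasurableSpace E] {p : ℝ} (hp : 1 ≤ p) {Ω : Set E}
    {u : E → ℝ} (hu : AEMeasurable u (volume.restrict Ω)) :
    lpIntegral p Ω u = 0 ↔ u =ᵐ[volume.restrict Ω] 0 := by
  unfold lpIntegral
  rw [lintegral_eq_zero_iff' (by fun_prop)]
  have : ∀ x, ENNReal.ofReal (|u x| ^ p) = 0 ↔ u x = 0 := fun x => by
    rw [ENNReal.ofReal_eq_zero]
    constructor
    · intro h
      by_contra h'
      have : 0 < |u x| ^ p := Real.rpow_pos_of_pos (abs_pos.2 h') _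
      linarith
    · intro h
      simp [h, Real.zero_rpow (by linarith : p ≠ 0)]
  simp only [Filter.EventuallyEq, Pi.zero_apply, this]

/-- Only `v` has to be measurable, because additivity of the lower integral needs measurability of
one summand. -/
lemma energy_le_weighted [BorelSpace E] [SecondCountableTopology E]
    [SFinite (volume : Measure E)] {p α θ : ℝ} (hp : 1 ≤ p) (h0 : 0 < θ)
    (h1 : θ < 1) {Ω : Set E} {u v w : E → ℝ} (hv : Measurable v)
    (h : ∀ x y, |u x - u y| ≤ |v x - v y| + |w x - w y|) :
    energy p α Ω u ≤ ENNReal.ofReal (θ ^ (1 - p)) * energy p α Ω v +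
      ENNReal.ofReal ((1 - θ) ^ (1 - p)) * energy p α Ω w := by
  have hm : Measurable fun z : E × E =>
      ENNReal.ofReal (θ ^ (1 - p)) *
        ENNReal.ofReal (|v z.1 - v z.2| ^ p / ‖z.1 - z.2‖ ^ α) := by fun_prop
  unfold energy
  rw [← lintegral_const_mul' _ _ ENNReal.ofReal_ne_top,
    ← lintegral_const_mul' _ _ ENNReal.ofReal_ne_top, ← lintegral_add_left]
  · refine lintegral_mono fun x => ?_
    rw [← lintegral_const_mul' _ _ ENNReal.ofReal_ne_top,
      ← lintegral_const_mul' _ _ ENNReal.ofReal_ne_top,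
      ← lintegral_add_left (by fun_prop)]
    exact lintegral_mono fun y => ofReal_rpow_div_le hp h0 h1 (h x y) (by positivity)
  · simp_rw [← lintegral_const_mul' _ _ (ENNReal.ofReal_ne_top (r := θ ^ (1 - p)))]
    exact hm.lintegral_prod_right'

end

section

variable {E : Type*} [NormedAddCommGroup E] [NormedSpace ℝ E] [MeasureSpace E]

lemma seminorm_rpow {s p : ℝ} (hp : 1 ≤ p) (Ω : Set E) (u : E → ℝ) :
    seminorm s p Ω u ^ p = ENNReal.ofReal (normConst (Module.finrank ℝ E) s p / 2) *
      energy p ((Module.finrank ℝ E : ℝ) + s * p) Ω u := by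
  unfold seminorm energy
  rw [← ENNReal.rpow_mul, one_div_mul_cancel (by linarith), ENNReal.rpow_one]

lemma seminorm_congr_ae {s p : ℝ} {Ω : Set E} {u v : E → ℝ} (h : u =ᵐ[volume.restrict Ω] v) :
    seminorm s p Ω u = seminorm s p Ω v := by
  change (_ * energy p _ Ω u) ^ (1 / p) = (_ * energy p _ Ω v) ^ (1 / p)
  rw [energy_congr_ae h]

/-! ### Reduction to test functions -/

lemma IsTest.measurable [OpensMeasurableSpace E] {Ω : Set E} {φ : E → ℝ} (h : IsTest Ω φ) :
    Measurable φ := h.1.continuous.measurable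

/-- A Poincaré inequality for test functions extends to `W_0^{s,p}`. -/
lemma mul_lpIntegral_le_of_test [BorelSpace E] [SecondCountableTopology E]
    [SFinite (volume : Measure E)] {s p : ℝ} (hp : 1 ≤ p) {Ω : Set E} {c : ℝ≥0∞} (hc : c ≠ ⊤)
    (H : ∀ φ, IsTest Ω φ → c * lpIntegral p Ω φ ≤ seminorm s p Ω φ ^ p)
    {u : E → ℝ} (hu : MemW0 s p Ω u) :
    c * lpIntegral p Ω u ≤ seminorm s p Ω u ^ p := by
  have hp0 : 0 < p := by linarith
  obtain ⟨u', hu'm, hu'⟩ := hu.1.1.aestronglyMeasurable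
  have hu'm := hu'm.measurable
  rw [lpIntegral_congr_ae hu', seminorm_congr_ae hu']
  -- Two weights are needed: τ for u' = φ + (u' - φ) in L^p, and θ for φ = u' - (u' - φ) in the
  -- seminorm. Both tend to 1 after the approximation error δ has tended to 0.
  refine le_of_forall_weight_mul_le (p := p) fun θ h0 h1 => ?_
  refine le_of_forall_weight_mul_le (p := p) fun τ k0 k1 => ?_
  set A := ENNReal.ofReal (θ ^ (1 - p))
  set B := ENNReal.ofReal ((1 - θ) ^ (1 - p))
  set A' := ENNReal.ofReal (τ ^ (1 - p))
  set B' := ENNReal.ofReal ((1 - τ) ^ (1 - p))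
  refine le_of_forall_pos_le_add_mul (C := A' * B + c * B') ?_ fun δ hδ => ?_
  · exact ENNReal.add_ne_top.2 ⟨ENNReal.mul_ne_top ENNReal.ofReal_ne_top ENNReal.ofReal_ne_top,
      ENNReal.mul_ne_top hc ENNReal.ofReal_ne_top⟩
  obtain ⟨φ, hφ, hlt⟩ := hu.2 (δ ^ (1 / p)) (ENNReal.rpow_pos_of_nonneg hδ (by positivity))
  have hae : (fun x => u x - φ x) =ᵐ[volume.restrict Ω] fun x => u' x - φ x := by
    filter_upwards [hu'] with x hx using by rw [hx]
  unfold sobolevNorm at hlt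
  rw [ENNReal.rpow_lt_rpow_iff (by positivity), lpIntegral_congr_ae hae,
    seminorm_congr_ae hae] at hlt
  have e1 : lpIntegral p Ω (fun x => u' x - φ x) ≤ δ := le_self_add.trans hlt.le
  have e2 : seminorm s p Ω (fun x => u' x - φ x) ^ p ≤ δ := le_add_self.trans hlt.le
  have i1 : lpIntegral p Ω u' ≤
      A' * lpIntegral p Ω φ + B' * lpIntegral p Ω (fun x => u' x - φ x) :=
    lpIntegral_le_weighted hp k0 k1 hφ.measurable fun x => by
      simpa using abs_add_le (φ x) (u' x - φ x)
  have i2 : seminorm s p Ω φ ^ p ≤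
      A * seminorm s p Ω u' ^ p + B * seminorm s p Ω (fun x => u' x - φ x) ^ p := by
    simp only [seminorm_rpow hp]
    refine (mul_le_mul_right (energy_le_weighted hp h0 h1 (v := u')
      (w := fun x => u' x - φ x) hu'm fun x y => ?_) _).trans_eq (by ring)
    have : φ x - φ y = (u' x - u' y) - ((u' x - φ x) - (u' y - φ y)) := by ring
    rw [this]
    exact abs_sub _ _
  calc c * lpIntegral p Ω u'
      ≤ c * (A' * lpIntegral p Ω φ + B' * δ) := by gcongr; exact i1.trans (by gcongr)
    _ = A' * (c * lpIntegral p Ω φ) + c * B' * δ := by ring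
    _ ≤ A' * (A * seminorm s p Ω u' ^ p + B * δ) + c * B' * δ := by
        gcongr
        exact (H φ hφ).trans (i2.trans (by gcongr))
    _ = A' * (A * seminorm s p Ω u' ^ p) + (A' * B + c * B') * δ := by ring

/-- The constant is bounded below by any constant valid for test functions. -/
lemma le_regionalConst_of_test [BorelSpace E] [SecondCountableTopology E]
    [SFinite (volume : Measure E)] {s p : ℝ} (hp : 1 ≤ p) {Ω : Set E} {c : ℝ≥0∞} (hc : c ≠ ⊤)
    (H : ∀ φ, IsTest Ω φ → c * lpIntegral p Ω φ ≤ seminorm s p Ω φ ^ p) :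
    c ≤ regionalConst s p Ω := by
  unfold regionalConst
  refine le_iInf fun u => le_iInf fun hu => le_iInf fun h0 => ?_
  rw [ENNReal.le_div_iff_mul_le (Or.inl ?_) (Or.inl (lpIntegral_ne_top hp hu.1.1))]
  · exact mul_lpIntegral_le_of_test hp hc H hu
  · rwa [Ne, lpIntegral_eq_zero_iff hp hu.1.1.aestronglyMeasurable.aemeasurable]

/-- The infimum only sees functions of finite seminorm that are not a.e. zero; in the two excluded
cases the inequality is trivial. Otherwise a test function is its own approximant in the closure. -/
lemma regionalConst_mul_lpIntegral_le [BorelSpace E] [IsFiniteMeasureOnCompacts (volume : Measure E)]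
    {s p : ℝ} (hp : 1 ≤ p) {Ω : Set E} {φ : E → ℝ} (hφ : IsTest Ω φ) :
    regionalConst s p Ω * lpIntegral p Ω φ ≤ seminorm s p Ω φ ^ p := by
  have hp0 : 0 < p := by linarith
  rcases eq_top_or_lt_top (seminorm s p Ω φ) with htop | hlt
  · rw [htop, ENNReal.top_rpow_of_pos (by linarith)]
    exact le_top
  by_cases h0 : φ =ᵐ[volume.restrict Ω] 0
  · rw [(lpIntegral_eq_zero_iff hp hφ.measurable.aemeasurable).2 h0, mul_zero]
    exact zero_le
  refine ENNReal.mul_le_of_le_div ?_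
  have hW : MemW0 s p Ω φ := by
    refine ⟨⟨(hφ.1.continuous.memLp_of_hasCompactSupport hφ.2.1).restrict _, hlt⟩,
      fun ε hε => ⟨φ, hφ, ?_⟩⟩
    have e1 : lpIntegral p Ω (fun x => φ x - φ x) = 0 := by
      simp [lpIntegral, Real.zero_rpow hp0.ne']
    have e2 : seminorm s p Ω (fun x => φ x - φ x) = 0 := by
      simp [seminorm, Real.zero_rpow hp0.ne', hp0]
    rw [sobolevNorm, e1, e2, ENNReal.zero_rpow_of_pos hp0, add_zero,
      ENNReal.zero_rpow_of_pos (by positivity)]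
    exact hε
  exact iInf_le_of_le φ (iInf_le_of_le hW (iInf_le_of_le h0 le_rfl))

end

/-! ### The slicing weight -/

/-- The weight `(1 + ‖z‖²) ^ (-(m + 1 + σ) / 2)` carried by the slicing direction `(1, z)`. -/
noncomputable def sliceWeight (m : ℕ) (σ : ℝ) (z : EuclideanSpace ℝ (Fin m)) : ℝ :=
  (1 + ‖z‖ ^ 2) ^ (-(((m : ℝ) + 1 + σ) / 2))

lemma sliceWeight_pos (m : ℕ) (σ : ℝ) (z : EuclideanSpace ℝ (Fin m)) : 0 < sliceWeight m σ z := by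
  unfold sliceWeight; positivity

@[fun_prop]
lemma measurable_sliceWeight (m : ℕ) (σ : ℝ) : Measurable (sliceWeight m σ) := by
  unfold sliceWeight; fun_prop

lemma lintegral_rpow_mul_exp {a r : ℝ} (ha : 0 < a) (hr : 0 < r) :
    ∫⁻ t in Set.Ioi (0 : ℝ), ENNReal.ofReal (t ^ (a - 1) * Real.exp (-(r * t))) =
      ENNReal.ofReal (r ^ (-a) * Real.Gamma a) := by
  have key := Real.integral_rpow_mul_exp_neg_mul_Ioi ha hr
  have hG := Real.Gamma_pos_of_pos ha
  rw [← ofReal_integral_eq_lintegral_ofReal (.of_integral_ne_zero (by rw [key]; positivity)), key,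
    one_div, Real.inv_rpow hr.le, Real.rpow_neg hr.le]
  filter_upwards [ae_restrict_mem measurableSet_Ioi] with t ht
  have : (0 : ℝ) < t := ht
  positivity

lemma lintegral_exp_neg_mul_sq_norm (m : ℕ) {b : ℝ} (hb : 0 < b) :
    ∫⁻ z : EuclideanSpace ℝ (Fin m), ENNReal.ofReal (Real.exp (-b * ‖z‖ ^ 2)) =
      ENNReal.ofReal ((Real.pi / b) ^ ((m : ℝ) / 2)) := by
  have key := GaussianFourier.integral_rexp_neg_mul_sq_norm (V := EuclideanSpace ℝ (Fin m)) hb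
  have hpi := Real.pi_pos
  rw [finrank_euclideanSpace_fin] at key
  rw [← ofReal_integral_eq_lintegral_ofReal (.of_integral_ne_zero (by rw [key]; positivity))
    (.of_forall fun z => by positivity), key]

/-- Write Γ(a)(1 + |z|²)^(-a) as the integral of t^(a-1) e^(-(1+|z|²)t) over t > 0, exchange the
integrals, and evaluate a Gaussian in z and then a Gamma integral in t. -/
lemma lintegral_one_add_norm_sq_rpow (m : ℕ) {a : ℝ} (ha : (m : ℝ) / 2 < a) :
    ∫⁻ z : EuclideanSpace ℝ (Fin m), ENNReal.ofReal ((1 + ‖z‖ ^ 2) ^ (-a)) =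
      ENNReal.ofReal (Real.pi ^ ((m : ℝ) / 2) * Real.Gamma (a - (m : ℝ) / 2) / Real.Gamma a) := by
  have hpi := Real.pi_pos
  have ha0 : 0 < a := lt_of_le_of_lt (by positivity) ha
  have hG := Real.Gamma_pos_of_pos ha0
  have hG' := Real.Gamma_pos_of_pos (sub_pos.2 ha)
  have h1 : ENNReal.ofReal (Real.Gamma a) *
      ∫⁻ z : EuclideanSpace ℝ (Fin m), ENNReal.ofReal ((1 + ‖z‖ ^ 2) ^ (-a)) =
      ENNReal.ofReal (Real.pi ^ ((m : ℝ) / 2) * Real.Gamma (a - (m : ℝ) / 2)) := by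
    calc _ = ∫⁻ z : EuclideanSpace ℝ (Fin m), ∫⁻ t in Set.Ioi (0 : ℝ),
          ENNReal.ofReal (t ^ (a - 1) * Real.exp (-((1 + ‖z‖ ^ 2) * t))) := by
          rw [← lintegral_const_mul' _ _ ENNReal.ofReal_ne_top]
          refine lintegral_congr fun z => ?_
          rw [lintegral_rpow_mul_exp ha0 (by positivity), ← ENNReal.ofReal_mul hG.le, mul_comm]
      _ = ∫⁻ t in Set.Ioi (0 : ℝ), ∫⁻ z : EuclideanSpace ℝ (Fin m),
          ENNReal.ofReal (t ^ (a - 1) * Real.exp (-((1 + ‖z‖ ^ 2) * t))) := by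
          rw [lintegral_lintegral_swap (by fun_prop)]
      _ = ∫⁻ t in Set.Ioi (0 : ℝ), ENNReal.ofReal (Real.pi ^ ((m : ℝ) / 2)) *
          ENNReal.ofReal (t ^ (a - (m : ℝ) / 2 - 1) * Real.exp (-(1 * t))) := by
          refine setLIntegral_congr_fun measurableSet_Ioi fun t ht => ?_
          have ht : (0 : ℝ) < t := ht
          have e : ∀ z : EuclideanSpace ℝ (Fin m),
              ENNReal.ofReal (t ^ (a - 1) * Real.exp (-((1 + ‖z‖ ^ 2) * t))) =
              ENNReal.ofReal (t ^ (a - 1) * Real.exp (-t)) *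
                ENNReal.ofReal (Real.exp (-t * ‖z‖ ^ 2)) := fun z => by
            rw [← ENNReal.ofReal_mul (by positivity), mul_assoc, ← Real.exp_add]
            ring_nf
          simp_rw [e]
          rw [lintegral_const_mul' _ _ ENNReal.ofReal_ne_top, lintegral_exp_neg_mul_sq_norm m ht,
            ← ENNReal.ofReal_mul (by positivity), ← ENNReal.ofReal_mul (by positivity)]
          congr 1
          rw [Real.div_rpow hpi.le ht.le, show a - (m : ℝ) / 2 - 1 = (a - 1) - (m : ℝ) / 2 by ring,
            Real.rpow_sub ht (a - 1), one_mul]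
          ring
      _ = _ := by
          rw [lintegral_const_mul' _ _ ENNReal.ofReal_ne_top,
            lintegral_rpow_mul_exp (sub_pos.2 ha) one_pos, Real.one_rpow, one_mul,
            ← ENNReal.ofReal_mul (by positivity)]
  rw [ENNReal.ofReal_div_of_pos hG, ← h1, mul_comm, ENNReal.mul_div_cancel_right]
  · simpa using hG
  · exact ENNReal.ofReal_ne_top

lemma lintegral_sliceWeight (m : ℕ) {σ : ℝ} (hσ : 0 < σ) :
    ∫⁻ z, ENNReal.ofReal (sliceWeight m σ z) =
      ENNReal.ofReal (Real.pi ^ ((m : ℝ) / 2) * Real.Gamma ((1 + σ) / 2) /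
        Real.Gamma (((m : ℝ) + 1 + σ) / 2)) := by
  unfold sliceWeight
  rw [lintegral_one_add_norm_sq_rpow m (by linarith)]
  ring_nf

/-- Integrating out the directions reduces the `m + 1`-dimensional normalisation constant to the
one-dimensional one. -/
lemma normConst_mul_lintegral_sliceWeight (m : ℕ) {s p : ℝ} (hs0 : 0 < s) (hs1 : s < 1)
    (hp : 1 ≤ p) :
    ENNReal.ofReal (normConst (m + 1) s p / 2) * ∫⁻ z, ENNReal.ofReal (sliceWeight m (s * p) z) =
      ENNReal.ofReal (normConst 1 s p / 2) := by
  have := normConst_pos (n := m + 1) hs0 hs1 hp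
  rw [lintegral_sliceWeight m (by positivity), ← ENNReal.ofReal_mul (by positivity)]
  congr 1
  unfold normConst
  have h1 : 0 < Real.Gamma (((m : ℝ) + 1 + s * p) / 2) := Real.Gamma_pos_of_pos (by positivity)
  have h2 : 0 < Real.Gamma (1 - s) := Real.Gamma_pos_of_pos (by linarith)
  have h3 : 0 < Real.Gamma ((p + 1) / 2) := Real.Gamma_pos_of_pos (by linarith)
  have h4 : 0 < Real.pi ^ ((m : ℝ) / 2) := Real.rpow_pos_of_pos Real.pi_pos _
  push_cast
  simp only [add_sub_cancel_right, sub_self, zero_div, Real.rpow_zero]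
  field_simp

/-! ### Slicing of the energy on `I × ℝ^m` -/

lemma lintegral_smul_comp (m : ℕ) {r : ℝ} (hr : r ≠ 0) {K : EuclideanSpace ℝ (Fin m) → ℝ≥0∞}
    (hK : Measurable K) (a : EuclideanSpace ℝ (Fin m)) :
    ∫⁻ y, K y = ENNReal.ofReal (|r| ^ m) * ∫⁻ z, K (a + r • z) := by
  have h := Measure.map_addHaar_smul (volume : Measure (EuclideanSpace ℝ (Fin m))) hr
  have hK' : Measurable fun y => K (a + y) := by fun_prop
  have h2 := lintegral_map hK' (measurable_const_smul r) (μ := volume)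
  rw [h, lintegral_smul_measure, finrank_euclideanSpace_fin,
    lintegral_add_left_eq_self (fun y => K y) a] at h2
  rw [← h2, smul_eq_mul, ← mul_assoc, ← ENNReal.ofReal_mul (by positivity), abs_inv, abs_pow,
    mul_inv_cancel₀ (by positivity), ENNReal.ofReal_one, one_mul]

/-- The points (x, a) and (x + r, a + rz) are at distance |r|(1 + |z|²)^(1/2). The Jacobian |r|^m of
b = a + rz lowers the kernel exponent from m + 1 + σ to 1 + σ. -/
lemma kernel_eq (m : ℕ) {σ r A : ℝ} (hr : r ≠ 0) (z : EuclideanSpace ℝ (Fin m)) :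
    ENNReal.ofReal (|r| ^ m) *
        ENNReal.ofReal (A / √(r ^ 2 + ‖r • z‖ ^ 2) ^ ((m : ℝ) + 1 + σ)) =
      ENNReal.ofReal (sliceWeight m σ z) * ENNReal.ofReal (A / |r| ^ (1 + σ)) := by
  have hr' : 0 < |r| := abs_pos.2 hr
  rw [← ENNReal.ofReal_mul (by positivity), ← ENNReal.ofReal_mul (sliceWeight_pos _ _ _).le]
  congr 1
  have h1 : r ^ 2 + ‖r • z‖ ^ 2 = |r| ^ 2 * (1 + ‖z‖ ^ 2) := by
    rw [norm_smul, Real.norm_eq_abs, mul_pow, sq_abs]; ring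
  rw [h1, Real.sqrt_mul (by positivity), Real.sqrt_sq hr'.le,
    Real.mul_rpow hr'.le (by positivity), sliceWeight, Real.rpow_neg (by positivity),
    Real.sqrt_eq_rpow, ← Real.rpow_mul (by positivity), add_assoc (m : ℝ), Real.rpow_add hr',
    Real.rpow_natCast]
  rw [show 1 / 2 * ((m : ℝ) + (1 + σ)) = ((m : ℝ) + (1 + σ)) / 2 by ring]
  field_simp

/-- The slicing identity in product coordinates. -/
lemma lintegral_slice (m : ℕ) {p σ : ℝ} {I : Set ℝ}
    {U : ℝ × EuclideanSpace ℝ (Fin m) → ℝ} (hU : Measurable U) :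
    ∫⁻ x in I, ∫⁻ a, ∫⁻ y in I, ∫⁻ b,
        ENNReal.ofReal (|U (x, a) - U (y, b)| ^ p /
          √((x - y) ^ 2 + ‖a - b‖ ^ 2) ^ ((m : ℝ) + 1 + σ)) =
      ∫⁻ z, ENNReal.ofReal (sliceWeight m σ z) *
        ∫⁻ a, energy p (1 + σ) I (fun t => U (t, a + t • z)) := by
  let F := EuclideanSpace ℝ (Fin m)
  -- The integrand after the substitution b = a + (y - x)z, which is legitimate off the null set y =
  -- x.
  let H : ℝ → F → ℝ → F → ℝ≥0∞ := fun x a y z => ENNReal.ofReal (sliceWeight m σ z) *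
    ENNReal.ofReal (|U (x, a) - U (y, a + (y - x) • z)| ^ p / |x - y| ^ (1 + σ))
  have hH : Measurable fun q : ℝ × F × ℝ × F => H q.1 q.2.1 q.2.2.1 q.2.2.2 := by fun_prop
  have hin : ∀ x a, ∀ᵐ y ∂(volume.restrict I), ∫⁻ b : F,
        ENNReal.ofReal (|U (x, a) - U (y, b)| ^ p /
          √((x - y) ^ 2 + ‖a - b‖ ^ 2) ^ ((m : ℝ) + 1 + σ)) = ∫⁻ z, H x a y z := by
    intro x a
    filter_upwards [ae_restrict_of_ae (Measure.ae_ne volume x)] with y hy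
    rw [lintegral_smul_comp m (sub_ne_zero.2 hy) (by fun_prop) a,
      ← lintegral_const_mul' _ _ ENNReal.ofReal_ne_top]
    refine lintegral_congr fun z => ?_
    have e1 : (x - y) ^ 2 = (y - x) ^ 2 := by ring
    have e2 : ‖a - (a + (y - x) • z)‖ = ‖(y - x) • z‖ := by
      rw [sub_add_cancel_left, norm_neg]
    rw [e1, e2, kernel_eq m (sub_ne_zero.2 hy)]
    simp only [H, abs_sub_comm x y]
  have m1 : ∀ x, Measurable fun q : F × F => ∫⁻ y in I, H x q.1 y q.2 := fun x =>
    Measurable.lintegral_prod_right' (f := fun q : (F × F) × ℝ => H x q.1.1 q.2 q.1.2)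
      (by fun_prop)
  calc _ = ∫⁻ x in I, ∫⁻ a, ∫⁻ y in I, ∫⁻ z, H x a y z :=
        lintegral_congr fun x => lintegral_congr fun a => lintegral_congr_ae (hin x a)
    _ = ∫⁻ x in I, ∫⁻ a, ∫⁻ z, ∫⁻ y in I, H x a y z :=
        lintegral_congr fun x => lintegral_congr fun a =>
          lintegral_lintegral_swap (by fun_prop)
    _ = ∫⁻ x in I, ∫⁻ z, ∫⁻ a, ∫⁻ y in I, H x a y z :=
        lintegral_congr fun x => lintegral_lintegral_swap (m1 x).aemeasurable
    -- Translating a by xz puts both points, (x, a + xz) and (y, a + yz), on one line that depends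
    -- only on (a, z).
    _ = ∫⁻ x in I, ∫⁻ z, ∫⁻ a, ∫⁻ y in I, H x (a + x • z) y z :=
        lintegral_congr fun x => lintegral_congr fun z =>
          (lintegral_add_right_eq_self (fun a => ∫⁻ y in I, H x a y z) (x • z)).symm
    _ = ∫⁻ z, ∫⁻ x in I, ∫⁻ a, ∫⁻ y in I, H x (a + x • z) y z := by
        refine lintegral_lintegral_swap (Measurable.aemeasurable ?_)
        refine Measurable.lintegral_prod_right'
          (f := fun q : (ℝ × F) × F => ∫⁻ y in I, H q.1.1 (q.2 + q.1.1 • q.1.2) y q.1.2) ?_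
        exact Measurable.lintegral_prod_right' (f := fun q : ((ℝ × F) × F) × ℝ =>
          H q.1.1.1 (q.1.2 + q.1.1.1 • q.1.1.2) q.2 q.1.1.2) (by fun_prop)
    _ = ∫⁻ z, ∫⁻ a, ∫⁻ x in I, ∫⁻ y in I, H x (a + x • z) y z := by
        refine lintegral_congr fun z => lintegral_lintegral_swap (Measurable.aemeasurable ?_)
        exact Measurable.lintegral_prod_right' (f := fun q : (ℝ × F) × ℝ =>
          H q.1.1 (q.1.2 + q.1.1 • z) q.2 z) (by fun_prop)
    _ = _ := by
        refine lintegral_congr fun z => ?_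
        rw [← lintegral_const_mul' _ _ ENNReal.ofReal_ne_top]
        refine lintegral_congr fun a => ?_
        unfold energy
        rw [← lintegral_const_mul' _ _ ENNReal.ofReal_ne_top]
        refine lintegral_congr fun x => ?_
        rw [← lintegral_const_mul' _ _ ENNReal.ofReal_ne_top]
        refine lintegral_congr fun y => ?_
        simp only [H, Real.norm_eq_abs]
        rw [add_assoc, ← add_smul, add_sub_cancel]

/-! ### Coordinates on the strip -/

/-- The isometric coordinates `ℝ × ℝ^m → ℝ^(m+1)`. -/
noncomputable def stripCoord (m : ℕ) (q : ℝ × EuclideanSpace ℝ (Fin m)) :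
    EuclideanSpace ℝ (Fin (m + 1)) :=
  WithLp.toLp 2 (Fin.cons q.1 q.2.ofLp)

lemma contDiff_stripCoord (m : ℕ) : ContDiff ℝ (⊤ : ℕ∞) (stripCoord m) := by
  rw [contDiff_euclidean]
  intro i
  refine Fin.cases ?_ (fun j => ?_) i
  · exact contDiff_fst
  · change ContDiff ℝ _ fun q : ℝ × EuclideanSpace ℝ (Fin m) => q.2 j
    fun_prop

lemma norm_stripCoord_sub (m : ℕ) (x y : ℝ) (a b : EuclideanSpace ℝ (Fin m)) :
    ‖stripCoord m (x, a) - stripCoord m (y, b)‖ = √((x - y) ^ 2 + ‖a - b‖ ^ 2) := by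
  rw [EuclideanSpace.norm_eq, EuclideanSpace.norm_eq, Fin.sum_univ_succ,
    Real.sq_sqrt (by positivity)]
  simp [stripCoord]

lemma measurePreserving_stripCoord (m : ℕ) :
    MeasurePreserving (stripCoord m) (volume.prod volume) volume := by
  have h1 := (volume_preserving_piFinSuccAbove (fun _ : Fin (m + 1) => ℝ) 0).symm
  have h2 := PiLp.volume_preserving_toLp (Fin (m + 1))
  have h3 := (MeasurePreserving.id (volume : Measure ℝ)).prod (PiLp.volume_preserving_ofLp (Fin m))
  have h := h2.comp (h1.comp h3)
  convert! h using 1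
  funext q
  ext i
  refine Fin.cases rfl (fun j => rfl) i

lemma lintegral_strip (m : ℕ) {hn : 1 ≤ m + 1} {f : EuclideanSpace ℝ (Fin (m + 1)) → ℝ≥0∞}
    (hf : Measurable f) :
    ∫⁻ x in strip (m + 1) hn, f x =
      ∫⁻ t in Set.Ioo (-1 : ℝ) 1, ∫⁻ a, f (stripCoord m (t, a)) := by
  have hs : MeasurableSet (strip (m + 1) hn) :=
    (by fun_prop : Measurable fun x : EuclideanSpace ℝ (Fin (m + 1)) => x 0) measurableSet_Ioo
  have hpre : stripCoord m ⁻¹' strip (m + 1) hn = Set.Ioo (-1 : ℝ) 1 ×ˢ Set.univ := by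
    ext q; simp [strip, stripCoord]
  have hm : Measurable fun q => f (stripCoord m q) :=
    hf.comp (contDiff_stripCoord m).continuous.measurable
  rw [← (measurePreserving_stripCoord m).setLIntegral_comp_preimage hs hf, hpre,
    ← Measure.prod_restrict, Measure.restrict_univ, lintegral_prod _ hm.aemeasurable]

lemma energy_strip (m : ℕ) {hn : 1 ≤ m + 1} {p σ : ℝ}
    {u : EuclideanSpace ℝ (Fin (m + 1)) → ℝ} (hu : Measurable u) :
    energy p ((m : ℝ) + 1 + σ) (strip (m + 1) hn) u =
      ∫⁻ z, ENNReal.ofReal (sliceWeight m σ z) *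
        ∫⁻ a, energy p (1 + σ) (Set.Ioo (-1 : ℝ) 1) (fun t => u (stripCoord m (t, a + t • z))) := by
  have hT := (contDiff_stripCoord m).continuous.measurable
  rw [← lintegral_slice m (U := fun q => u (stripCoord m q)) (by fun_prop)]
  unfold energy
  rw [lintegral_strip]
  · refine lintegral_congr fun x => lintegral_congr fun a => ?_
    rw [lintegral_strip m (by fun_prop)]
    simp_rw [norm_stripCoord_sub]
  · exact Measurable.lintegral_prod_right' (f := fun q : EuclideanSpace ℝ (Fin (m + 1)) ×
      EuclideanSpace ℝ (Fin (m + 1)) => ENNReal.ofReal (|u q.1 - u q.2| ^ p /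
        ‖q.1 - q.2‖ ^ ((m : ℝ) + 1 + σ))) (by fun_prop)

/-- The shear (t, a) ↦ (t, a + tz) preserves measure, so the identity holds for each slope z
separately and can then be integrated against the slice weight. -/
lemma lpIntegral_strip (m : ℕ) {hn : 1 ≤ m + 1} {p : ℝ}
    {u : EuclideanSpace ℝ (Fin (m + 1)) → ℝ} (hu : Measurable u)
    (z : EuclideanSpace ℝ (Fin m)) :
    lpIntegral p (strip (m + 1) hn) u =
      ∫⁻ a, lpIntegral p (Set.Ioo (-1 : ℝ) 1) (fun t => u (stripCoord m (t, a + t • z))) := by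
  have hT := (contDiff_stripCoord m).continuous.measurable
  unfold lpIntegral
  rw [lintegral_strip m (by fun_prop)]
  refine (lintegral_congr fun x => ?_).trans
    (lintegral_lintegral_swap (Measurable.aemeasurable (by fun_prop)))
  exact (lintegral_add_right_eq_self
    (fun a => ENNReal.ofReal (|u (stripCoord m (x, a))| ^ p)) (x • z)).symm

lemma IsTest.slice {m : ℕ} {hn : 1 ≤ m + 1} {φ : EuclideanSpace ℝ (Fin (m + 1)) → ℝ}
    (hφ : IsTest (strip (m + 1) hn) φ) (a z : EuclideanSpace ℝ (Fin m)) :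
    IsTest (Set.Ioo (-1 : ℝ) 1) (fun t => φ (stripCoord m (t, a + t • z))) := by
  have hL : ContDiff ℝ (⊤ : ℕ∞) fun t : ℝ => stripCoord m (t, a + t • z) :=
    (contDiff_stripCoord m).comp (by fun_prop)
  have hsub : tsupport (fun t => φ (stripCoord m (t, a + t • z))) ⊆ Set.Ioo (-1 : ℝ) 1 := by
    refine (tsupport_comp_subset_preimage φ hL.continuous).trans fun t ht => ?_
    exact hφ.2.2 ht
  refine ⟨hφ.1.comp hL, ?_, hsub⟩
  exact isCompact_Icc.of_isClosed_subset (isClosed_tsupport _) (hsub.trans Set.Ioo_subset_Icc_self)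

/-- Slicing: the interval constant bounds the strip constant from below. -/
lemma regionalConst_Ioo_le_strip (m : ℕ) {hn : 1 ≤ m + 1} {s p : ℝ} (hs0 : 0 < s) (hs1 : s < 1)
    (hp : 1 ≤ p) (hfin : regionalConst s p (Set.Ioo (-1 : ℝ) 1) ≠ ⊤) :
    regionalConst s p (Set.Ioo (-1 : ℝ) 1) ≤ regionalConst s p (strip (m + 1) hn) := by
  refine le_regionalConst_of_test hp hfin fun φ hφ => ?_
  set P := regionalConst s p (Set.Ioo (-1 : ℝ) 1)
  set L := lpIntegral p (strip (m + 1) hn) φ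
  have hpos : ENNReal.ofReal (normConst 1 s p / 2) ≠ 0 := by
    simpa using normConst_pos (n := 1) hs0 hs1 hp
  rw [seminorm_rpow hp, finrank_euclideanSpace_fin]
  push_cast
  rw [energy_strip m hφ.measurable]
  set c := ENNReal.ofReal (normConst (m + 1) s p / 2)
  set c1 := ENNReal.ofReal (normConst 1 s p / 2) with hc1
  -- The interval inequality brings a factor `c1` on the right of each slice, and the total slice
  -- weight turns `c` into `c1` on the left; multiplying the goal by `c1` makes the two match.
  rw [← ENNReal.mul_le_mul_iff_right hpos ENNReal.ofReal_ne_top]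
  have hslice : ∀ z, P * L ≤ c1 * ∫⁻ a,
      energy p (1 + s * p) (Set.Ioo (-1 : ℝ) 1) (fun t => φ (stripCoord m (t, a + t • z))) := by
    intro z
    rw [show L = _ from lpIntegral_strip m hφ.measurable z, ← lintegral_const_mul' _ _ hfin,
      ← lintegral_const_mul' _ _ ENNReal.ofReal_ne_top]
    refine lintegral_mono fun a => ?_
    have h := regionalConst_mul_lpIntegral_le (s := s) hp (hφ.slice a z)
    rw [seminorm_rpow hp, Module.finrank_self] at h
    simpa [hc1] using h
  calc c1 * (P * L) = c * ((∫⁻ z, ENNReal.ofReal (sliceWeight m (s * p) z)) * (P * L)) := by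
        rw [hc1, ← normConst_mul_lintegral_sliceWeight m hs0 hs1 hp]; ring
    _ = c * ∫⁻ z, ENNReal.ofReal (sliceWeight m (s * p) z) * (P * L) := by
        rw [lintegral_mul_const _ (by fun_prop)]
    _ ≤ c * ∫⁻ z, ENNReal.ofReal (sliceWeight m (s * p) z) * (c1 * ∫⁻ a,
        energy p (1 + s * p) (Set.Ioo (-1 : ℝ) 1) (fun t => φ (stripCoord m (t, a + t • z)))) := by
        exact mul_le_mul_right (lintegral_mono fun z => mul_le_mul_right (hslice z) _) _
    _ = _ := by
        simp_rw [mul_left_comm _ c1]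
        rw [lintegral_const_mul' c1 _ ENNReal.ofReal_ne_top, mul_left_comm]

/-! ### Integrability of the one-dimensional kernel -/

lemma lintegral_abs_rpow_lt_top {c : ℝ} (hc : 0 < c) :
    ∫⁻ h in Set.Ioo (-2 : ℝ) 2, ENNReal.ofReal (|h| ^ (c - 1)) < ⊤ := by
  have h1 : IntervalIntegrable (fun h : ℝ => |h| ^ (c - 1)) volume (-2) 2 := by
    refine intervalIntegrable_of_even (fun x => by rw [abs_neg]) (fun x hx => ?_)
    refine (intervalIntegral.intervalIntegrable_rpow' (a := 0) (b := x)
      (by linarith : -1 < c - 1)).congr fun y hy => ?_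
    rw [Set.uIoc_of_le hx.le] at hy
    simp only [abs_of_pos hy.1]
  rw [intervalIntegrable_iff_integrableOn_Ioo_of_le (by norm_num)] at h1
  exact h1.lintegral_lt_top

lemma setLIntegral_abs_sub_rpow_le {c x : ℝ} (hx : x ∈ Set.Ioo (-1 : ℝ) 1) :
    ∫⁻ y in Set.Ioo (-1 : ℝ) 1, ENNReal.ofReal (|x - y| ^ (c - 1)) ≤
      ∫⁻ h in Set.Ioo (-2 : ℝ) 2, ENNReal.ofReal (|h| ^ (c - 1)) := by
  rw [← lintegral_indicator measurableSet_Ioo, ← lintegral_indicator measurableSet_Ioo,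
    ← lintegral_sub_left_eq_self
      ((Set.Ioo (-2 : ℝ) 2).indicator fun h => ENNReal.ofReal (|h| ^ (c - 1))) x]
  refine lintegral_mono fun y => ?_
  by_cases hy : y ∈ Set.Ioo (-1 : ℝ) 1
  · have : x - y ∈ Set.Ioo (-2 : ℝ) 2 :=
      ⟨by linarith [hx.1, hy.2], by linarith [hx.2, hy.1]⟩
    rw [Set.indicator_of_mem hy, Set.indicator_of_mem this]
  · rw [Set.indicator_of_notMem hy]
    exact zero_le

lemma lintegral_abs_sub_rpow_lt_top {c : ℝ} (hc : 0 < c) :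
    ∫⁻ x in Set.Ioo (-1 : ℝ) 1, ∫⁻ y in Set.Ioo (-1 : ℝ) 1,
      ENNReal.ofReal (|x - y| ^ (c - 1)) < ⊤ := by
  refine lt_of_le_of_lt (setLIntegral_mono measurable_const
    fun x hx => setLIntegral_abs_sub_rpow_le hx) ?_
  rw [lintegral_const]
  exact ENNReal.mul_lt_top (lintegral_abs_rpow_lt_top hc) (by simp)

/-- An inequality rather than an equality so as to include the diagonal d = 0, where the left side
is 0 because q > 0. -/
lemma rpow_div_rpow_le {d q σ : ℝ} (hd : 0 ≤ d) (hq : 0 < q) :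
    d ^ q / d ^ (1 + σ) ≤ d ^ (q - σ - 1) := by
  rcases hd.eq_or_lt with rfl | hd
  · rw [Real.zero_rpow hq.ne', zero_div]; positivity
  · rw [← Real.rpow_sub hd]
    exact le_of_eq (by ring_nf)

lemma energy_lt_top_of_lipschitz {p σ : ℝ} (hp : 1 ≤ p) (hσ : σ < p) {L : NNReal} {u : ℝ → ℝ}
    (hu : LipschitzWith L u) : energy p (1 + σ) (Set.Ioo (-1 : ℝ) 1) u < ⊤ := by
  have h1 : energy p (1 + σ) (Set.Ioo (-1 : ℝ) 1) u ≤ ENNReal.ofReal ((L : ℝ) ^ p) *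
      ∫⁻ x in Set.Ioo (-1 : ℝ) 1, ∫⁻ y in Set.Ioo (-1 : ℝ) 1,
        ENNReal.ofReal (|x - y| ^ (p - σ - 1)) := by
    unfold energy
    rw [← lintegral_const_mul' _ _ ENNReal.ofReal_ne_top]
    refine lintegral_mono fun x => ?_
    rw [← lintegral_const_mul' _ _ ENNReal.ofReal_ne_top]
    refine lintegral_mono fun y => ?_
    rw [← ENNReal.ofReal_mul (by positivity)]
    refine ENNReal.ofReal_le_ofReal ?_
    have h := hu.dist_le_mul x y
    rw [Real.dist_eq, Real.dist_eq] at h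
    rw [Real.norm_eq_abs]
    calc |u x - u y| ^ p / |x - y| ^ (1 + σ) ≤ (L * |x - y|) ^ p / |x - y| ^ (1 + σ) := by gcongr
      _ = (L : ℝ) ^ p * (|x - y| ^ p / |x - y| ^ (1 + σ)) := by
          rw [Real.mul_rpow (by positivity) (by positivity), mul_div_assoc]
      _ ≤ _ := by gcongr; exact rpow_div_rpow_le (abs_nonneg _) (by linarith)
  exact h1.trans_lt (ENNReal.mul_lt_top ENNReal.ofReal_lt_top
    (lintegral_abs_sub_rpow_lt_top (sub_pos.2 hσ)))

lemma IsTest.energy_lt_top {p σ : ℝ} (hp : 1 ≤ p) (hσ : σ < p) {φ : ℝ → ℝ} {Ω : Set ℝ}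
    (hφ : IsTest Ω φ) : energy p (1 + σ) (Set.Ioo (-1 : ℝ) 1) φ < ⊤ := by
  obtain ⟨L, hL⟩ := hφ.1.lipschitzWith_of_hasCompactSupport hφ.2.1 (by simp)
  exact energy_lt_top_of_lipschitz hp hσ hL

/-- Since |z|^q ≤ (1 + |z|²)^(q/2), the weight keeps the exponent (m + 1 + σ - q)/2, which exceeds
m/2 exactly when q < 1 + σ. -/
lemma lintegral_sliceWeight_mul_norm_lt_top (m : ℕ) {σ q : ℝ} (hq0 : 0 < q) (hq : q < 1 + σ) :
    ∫⁻ z, ENNReal.ofReal (sliceWeight m σ z) * ENNReal.ofReal (‖z‖ ^ q) < ⊤ := by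
  have h := lintegral_one_add_norm_sq_rpow m (a := ((m : ℝ) + 1 + σ - q) / 2) (by linarith)
  refine lt_of_le_of_lt (lintegral_mono fun z => ?_) (h.trans_lt ENNReal.ofReal_lt_top)
  rw [← ENNReal.ofReal_mul (sliceWeight_pos _ _ _).le]
  refine ENNReal.ofReal_le_ofReal ?_
  have h1 : ‖z‖ ^ q ≤ (1 + ‖z‖ ^ 2) ^ (q / 2) := by
    have : ‖z‖ ^ q = (‖z‖ ^ 2) ^ (q / 2) := by
      rw [← Real.rpow_natCast, ← Real.rpow_mul (norm_nonneg _)]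
      congr 1
      push_cast
      ring
    rw [this]
    exact Real.rpow_le_rpow (by positivity) (by linarith) (by positivity)
  calc _ ≤ sliceWeight m σ z * (1 + ‖z‖ ^ 2) ^ (q / 2) := by
        gcongr
        exact (sliceWeight_pos _ _ _).le
    _ = _ := by
        rw [sliceWeight, ← Real.rpow_add (by positivity)]
        ring_nf

/-! ### Cutoffs in the unbounded directions -/

/-- Interpolates between the bound 1 and a Lipschitz bound t. The lower power q is needed because
the p-th moment of the slice weight may be infinite. -/
lemma min_one_rpow_le {d t p q : ℝ} (hd0 : 0 ≤ d) (hd1 : d ≤ 1) (hdt : d ≤ t) (hq : 0 < q)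
    (hqp : q ≤ p) : d ^ p ≤ t ^ q := by
  rcases hd0.eq_or_lt with rfl | hd
  · rw [Real.zero_rpow (by linarith)]; positivity
  · exact (Real.rpow_le_rpow_of_exponent_ge hd hd1 hqp).trans (Real.rpow_le_rpow hd0 hdt hq.le)

/-- A smooth cutoff equal to `1` on the unit ball and supported in the ball of radius `2`. -/
noncomputable def unitBump (m : ℕ) : ContDiffBump (0 : EuclideanSpace ℝ (Fin m)) :=
  ⟨1, 2, one_pos, one_lt_two⟩

/-- The cutoff at scale `R`. -/
noncomputable def cutoff (m : ℕ) (R : ℝ) (a : EuclideanSpace ℝ (Fin m)) : ℝ :=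
  unitBump m (R⁻¹ • a)

lemma contDiff_cutoff (m : ℕ) (R : ℝ) : ContDiff ℝ (⊤ : ℕ∞) (cutoff m R) :=
  (unitBump m).contDiff.comp (by fun_prop)

lemma cutoff_eq_zero {m : ℕ} {R : ℝ} (hR : 0 < R) {a : EuclideanSpace ℝ (Fin m)}
    (ha : a ∉ Metric.ball 0 (2 * R)) : cutoff m R a = 0 := by
  refine (unitBump m).zero_of_le_dist ?_
  rw [dist_zero_right, norm_smul, norm_inv, Real.norm_eq_abs, abs_of_pos hR]
  simp only [mem_ball_zero_iff, not_lt] at ha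
  change 2 ≤ R⁻¹ * ‖a‖
  rw [← div_eq_inv_mul, le_div_iff₀ hR]
  exact ha

lemma cutoff_eq_one {m : ℕ} {R : ℝ} (hR : 0 < R) {a : EuclideanSpace ℝ (Fin m)}
    (ha : a ∈ Metric.ball 0 R) : cutoff m R a = 1 := by
  refine (unitBump m).one_of_mem_closedBall ?_
  rw [mem_closedBall_zero_iff, norm_smul, norm_inv, Real.norm_eq_abs, abs_of_pos hR]
  simp only [mem_ball_zero_iff] at ha
  change R⁻¹ * ‖a‖ ≤ 1
  rw [← div_eq_inv_mul, div_le_one hR]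
  exact ha.le

lemma cutoff_nonneg (m : ℕ) (R : ℝ) (a : EuclideanSpace ℝ (Fin m)) : 0 ≤ cutoff m R a :=
  (unitBump m).nonneg

lemma cutoff_le_one (m : ℕ) (R : ℝ) (a : EuclideanSpace ℝ (Fin m)) : cutoff m R a ≤ 1 :=
  (unitBump m).le_one

/-- The `L^p` mass of the cutoff. -/
noncomputable def cutoffMass (m : ℕ) (p R : ℝ) : ℝ≥0∞ :=
  ∫⁻ a, ENNReal.ofReal (|cutoff m R a| ^ p)

lemma volume_ball_le_cutoffMass {m : ℕ} {p R : ℝ} (hR : 0 < R) :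
    volume (Metric.ball (0 : EuclideanSpace ℝ (Fin m)) R) ≤ cutoffMass m p R := by
  rw [← setLIntegral_one]
  refine le_trans (le_of_eq ?_) (setLIntegral_le_lintegral (Metric.ball 0 R) _)
  refine setLIntegral_congr_fun measurableSet_ball fun a ha => ?_
  simp [cutoff_eq_one hR ha]

lemma cutoffMass_le {m : ℕ} {p R : ℝ} (hp : 1 ≤ p) (hR : 0 < R) :
    cutoffMass m p R ≤ volume (Metric.ball (0 : EuclideanSpace ℝ (Fin m)) (2 * R)) := by
  rw [← lintegral_indicator_one measurableSet_ball]
  refine lintegral_mono fun a => ?_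
  by_cases ha : a ∈ Metric.ball 0 (2 * R)
  · rw [Set.indicator_of_mem ha]
    refine ENNReal.ofReal_le_one.2 (Real.rpow_le_one (abs_nonneg _) ?_ (by linarith))
    rw [abs_of_nonneg (cutoff_nonneg _ _ _)]
    exact cutoff_le_one _ _ _
  · rw [cutoff_eq_zero hR ha, abs_zero, Real.zero_rpow (by linarith), ENNReal.ofReal_zero]
    exact zero_le

lemma volume_ball_two_mul_le {m : ℕ} {p R : ℝ} (hR : 0 < R) :
    volume (Metric.ball (0 : EuclideanSpace ℝ (Fin m)) (2 * R)) ≤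
      ENNReal.ofReal (2 ^ m) * cutoffMass m p R := by
  refine le_trans (le_of_eq ?_) (mul_le_mul_right (volume_ball_le_cutoffMass (p := p) hR) _)
  rw [Measure.addHaar_ball_mul_of_pos _ _ two_pos, finrank_euclideanSpace_fin]

/-- The cutoff at scale R is Lipschitz with constant L/R and takes values in [0, 1], and the
difference vanishes unless one of the points lies in the ball of radius 2R. The indicators keep the
error proportional to R^m, hence comparable with the cutoff mass. -/
lemma exists_cutoff_sub_rpow_le (m : ℕ) : ∃ L : ℝ, 0 ≤ L ∧ ∀ {p q R : ℝ}, 0 < q → q ≤ p → 0 < R →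
    ∀ b c : EuclideanSpace ℝ (Fin m), ENNReal.ofReal (|cutoff m R b - cutoff m R c| ^ p) ≤
      ENNReal.ofReal (L ^ q * R ^ (-q) * ‖b - c‖ ^ q) *
        ((Metric.ball 0 (2 * R)).indicator 1 b + (Metric.ball 0 (2 * R)).indicator 1 c) := by
  obtain ⟨L, hL⟩ := ((unitBump m).contDiff (n := 1)).lipschitzWith_of_hasCompactSupport
    (unitBump m).hasCompactSupport one_ne_zero
  refine ⟨L, L.2, fun {p q R} hq hqp hR b c => ?_⟩
  by_cases hbc : b ∉ Metric.ball 0 (2 * R) ∧ c ∉ Metric.ball 0 (2 * R)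
  · rw [cutoff_eq_zero hR hbc.1, cutoff_eq_zero hR hbc.2, sub_zero, abs_zero,
      Real.zero_rpow (by linarith), ENNReal.ofReal_zero]
    exact zero_le
  · have h1 : (1 : ℝ≥0∞) ≤ (Metric.ball (0 : EuclideanSpace ℝ (Fin m)) (2 * R)).indicator 1 b +
        (Metric.ball 0 (2 * R)).indicator 1 c := by
      by_cases hb : b ∈ Metric.ball 0 (2 * R)
      · rw [Set.indicator_of_mem hb]
        exact le_self_add
      · have hc : c ∈ Metric.ball 0 (2 * R) := by
          by_contra hc
          exact hbc ⟨hb, hc⟩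
        rw [Set.indicator_of_mem hc]
        exact le_add_self
    refine le_trans ?_ (mul_le_mul_right h1 _)
    rw [mul_one]
    refine ENNReal.ofReal_le_ofReal ?_
    have h2 := hL.dist_le_mul (R⁻¹ • b) (R⁻¹ • c)
    rw [Real.dist_eq, dist_eq_norm, ← smul_sub, norm_smul, norm_inv, Real.norm_eq_abs,
      abs_of_pos hR] at h2
    have h3 : |cutoff m R b - cutoff m R c| ≤ 1 := by
      rw [abs_le]
      constructor <;> linarith [cutoff_nonneg m R b, cutoff_nonneg m R c, cutoff_le_one m R b,
        cutoff_le_one m R c]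
    refine (min_one_rpow_le (abs_nonneg _) h3 h2 hq hqp).trans_eq ?_
    rw [Real.mul_rpow (by positivity) (by positivity), Real.mul_rpow (by positivity)
      (by positivity), Real.inv_rpow hR.le, Real.rpow_neg hR.le, mul_assoc]

/-! ### Product test functions on the strip. -/

/-- Projection of `ℝ^(m+1)` to the unbounded directions of the strip. -/
noncomputable def stripTail (m : ℕ) (x : EuclideanSpace ℝ (Fin (m + 1))) :
    EuclideanSpace ℝ (Fin m) := WithLp.toLp 2 (Fin.tail x.ofLp)

lemma contDiff_stripTail (m : ℕ) : ContDiff ℝ (⊤ : ℕ∞) (stripTail m) := by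
  rw [contDiff_euclidean]
  intro i
  change ContDiff ℝ _ fun x : EuclideanSpace ℝ (Fin (m + 1)) => x i.succ
  fun_prop

lemma stripCoord_stripTail (m : ℕ) (x : EuclideanSpace ℝ (Fin (m + 1))) :
    stripCoord m (x 0, stripTail m x) = x := by
  ext i
  exact Fin.cases rfl (fun j => rfl) i

/-- The product of a profile on `(-1,1)` and a cutoff in the unbounded directions. -/
noncomputable def stripTest (m : ℕ) (φ : ℝ → ℝ) (R : ℝ) (x : EuclideanSpace ℝ (Fin (m + 1))) : ℝ :=
  φ (x 0) * cutoff m R (stripTail m x)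

lemma stripTest_stripCoord (m : ℕ) (φ : ℝ → ℝ) (R t : ℝ) (a : EuclideanSpace ℝ (Fin m)) :
    stripTest m φ R (stripCoord m (t, a)) = φ t * cutoff m R a := rfl

lemma isTest_stripTest {m : ℕ} {hn : 1 ≤ m + 1} {φ : ℝ → ℝ} (hφ : IsTest (Set.Ioo (-1 : ℝ) 1) φ)
    {R : ℝ} (hR : 0 < R) : IsTest (strip (m + 1) hn) (stripTest m φ R) := by
  have hK : IsCompact (stripCoord m '' (tsupport φ ×ˢ Metric.closedBall 0 (2 * R))) :=
    (hφ.2.1.prod (isCompact_closedBall _ _)).image (contDiff_stripCoord m).continuous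
  have hsub : Function.support (stripTest m φ R) ⊆
      stripCoord m '' (tsupport φ ×ˢ Metric.closedBall 0 (2 * R)) := by
    intro x hx
    refine ⟨(x 0, stripTail m x), ⟨subset_tsupport _ (left_ne_zero_of_mul hx), ?_⟩,
      stripCoord_stripTail m x⟩
    by_contra hx'
    exact right_ne_zero_of_mul hx (cutoff_eq_zero hR fun h => hx' (Metric.ball_subset_closedBall h))
  refine ⟨?_, HasCompactSupport.of_support_subset_isCompact hK hsub,
    (closure_minimal hsub hK.isClosed).trans ?_⟩
  · exact (hφ.1.comp (by fun_prop)).mul ((contDiff_cutoff m R).comp (contDiff_stripTail m))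
  · rintro _ ⟨q, hq, rfl⟩
    exact hφ.2.2 hq.1

lemma lpIntegral_stripTest {m : ℕ} {hn : 1 ≤ m + 1} {p : ℝ} {φ : ℝ → ℝ}
    (hφ : IsTest (Set.Ioo (-1 : ℝ) 1) φ) {R : ℝ} (hR : 0 < R) :
    lpIntegral p (strip (m + 1) hn) (stripTest m φ R) =
      lpIntegral p (Set.Ioo (-1 : ℝ) 1) φ * cutoffMass m p R := by
  have hm := hφ.measurable
  unfold lpIntegral
  rw [lintegral_strip m (by have := (isTest_stripTest (hn := hn) hφ hR).measurable; fun_prop),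
    ← lintegral_mul_const _ (by fun_prop)]
  refine lintegral_congr fun t => ?_
  unfold cutoffMass
  rw [← lintegral_const_mul' _ _ ENNReal.ofReal_ne_top]
  refine lintegral_congr fun a => ?_
  rw [stripTest_stripCoord, abs_mul, Real.mul_rpow (abs_nonneg _) (abs_nonneg _),
    ENNReal.ofReal_mul (by positivity)]

lemma lintegral_indicator_ball_add (m : ℕ) (r : ℝ) (v : EuclideanSpace ℝ (Fin m)) :
    ∫⁻ a, (Metric.ball (0 : EuclideanSpace ℝ (Fin m)) r).indicator
      (1 : EuclideanSpace ℝ (Fin m) → ℝ≥0∞) (a + v) =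
      volume (Metric.ball (0 : EuclideanSpace ℝ (Fin m)) r) := by
  rw [lintegral_add_right_eq_self (fun a => (Metric.ball 0 r).indicator
      (1 : EuclideanSpace ℝ (Fin m) → ℝ≥0∞) a) v,
    lintegral_indicator_one measurableSet_ball]

/-- Main term of the energy of `stripTest`, in the slice direction `z`. -/
lemma lintegral_slice_main {m : ℕ} {p σ R : ℝ} {φ : ℝ → ℝ} (hφ : Measurable φ)
    (z : EuclideanSpace ℝ (Fin m)) :
    ∫⁻ a, ∫⁻ x in Set.Ioo (-1 : ℝ) 1, ∫⁻ y in Set.Ioo (-1 : ℝ) 1,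
      ENNReal.ofReal (|(φ x - φ y) * cutoff m R (a + x • z)| ^ p / |x - y| ^ (1 + σ)) =
    energy p (1 + σ) (Set.Ioo (-1 : ℝ) 1) φ * cutoffMass m p R := by
  have hc := (contDiff_cutoff m R).continuous.measurable
  have hg : Measurable fun x => ∫⁻ y in Set.Ioo (-1 : ℝ) 1,
      ENNReal.ofReal (|φ x - φ y| ^ p / |x - y| ^ (1 + σ)) :=
    Measurable.lintegral_prod_right' (f := fun q : ℝ × ℝ =>
      ENNReal.ofReal (|φ q.1 - φ q.2| ^ p / |q.1 - q.2| ^ (1 + σ))) (by fun_prop)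
  have e : ∀ x y a, ENNReal.ofReal (|(φ x - φ y) * cutoff m R (a + x • z)| ^ p /
      |x - y| ^ (1 + σ)) = ENNReal.ofReal (|φ x - φ y| ^ p / |x - y| ^ (1 + σ)) *
        ENNReal.ofReal (|cutoff m R (a + x • z)| ^ p) := fun x y a => by
    rw [← ENNReal.ofReal_mul (by positivity), abs_mul,
      Real.mul_rpow (abs_nonneg _) (abs_nonneg _), div_mul_eq_mul_div]
  simp_rw [e, lintegral_mul_const' _ _ ENNReal.ofReal_ne_top]
  rw [lintegral_lintegral_swap (Measurable.aemeasurable (by fun_prop))]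
  simp only [energy, Real.norm_eq_abs]
  rw [← lintegral_mul_const _ hg]
  refine lintegral_congr fun x => ?_
  rw [lintegral_const_mul _ (by fun_prop),
    lintegral_add_right_eq_self (fun a => ENNReal.ofReal (|cutoff m R a| ^ p)) (x • z)]
  rfl

/-- Error term of the energy of `stripTest`, in the slice direction `z`. -/
lemma lintegral_slice_error_le {m : ℕ} {p σ q : ℝ} (hq : 0 < q) (hqp : q ≤ p)
    {φ : ℝ → ℝ} {M : ℝ} (hM : ∀ x, |φ x| ≤ M) {L R : ℝ} (hR : 0 < R) (hL0 : 0 ≤ L)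
    (hL : ∀ b c : EuclideanSpace ℝ (Fin m), ENNReal.ofReal (|cutoff m R b - cutoff m R c| ^ p) ≤
      ENNReal.ofReal (L ^ q * R ^ (-q) * ‖b - c‖ ^ q) *
        ((Metric.ball 0 (2 * R)).indicator 1 b + (Metric.ball 0 (2 * R)).indicator 1 c))
    (z : EuclideanSpace ℝ (Fin m)) :
    ∫⁻ a, ∫⁻ x in Set.Ioo (-1 : ℝ) 1, ∫⁻ y in Set.Ioo (-1 : ℝ) 1,
      ENNReal.ofReal (|φ y * (cutoff m R (a + x • z) - cutoff m R (a + y • z))| ^ p /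
        |x - y| ^ (1 + σ)) ≤
    ENNReal.ofReal (‖z‖ ^ q) * (ENNReal.ofReal (M ^ p * L ^ q * R ^ (-q)) *
      (∫⁻ x in Set.Ioo (-1 : ℝ) 1, ∫⁻ y in Set.Ioo (-1 : ℝ) 1,
        ENNReal.ofReal (|x - y| ^ (q - σ - 1))) *
      (2 * volume (Metric.ball (0 : EuclideanSpace ℝ (Fin m)) (2 * R)))) := by
  have hM0 : 0 ≤ M := (abs_nonneg _).trans (hM 0)
  let F := EuclideanSpace ℝ (Fin m)
  let B : F → ℝ≥0∞ := (Metric.ball 0 (2 * R)).indicator 1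
  have hB : Measurable B := measurable_one.indicator measurableSet_ball
  let g : ℝ → ℝ → ℝ≥0∞ := fun x y =>
    ENNReal.ofReal (‖z‖ ^ q) * ENNReal.ofReal (M ^ p * L ^ q * R ^ (-q)) *
      ENNReal.ofReal (|x - y| ^ (q - σ - 1))
  have hg : Measurable fun q : ℝ × ℝ => g q.1 q.2 := by fun_prop
  have hpt : ∀ x y a, ENNReal.ofReal (|φ y * (cutoff m R (a + x • z) - cutoff m R (a + y • z))| ^ p /
        |x - y| ^ (1 + σ)) ≤ g x y * (B (a + x • z) + B (a + y • z)) := by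
    intro x y a
    have h1 := hL (a + x • z) (a + y • z)
    rw [add_sub_add_left_eq_sub, ← sub_smul, norm_smul, Real.norm_eq_abs] at h1
    rw [abs_mul, Real.mul_rpow (abs_nonneg _) (abs_nonneg _), mul_div_right_comm,
      ENNReal.ofReal_mul (by positivity)]
    refine (mul_le_mul_right h1 _).trans ?_
    rw [← mul_assoc]
    refine mul_le_mul_left ?_ _
    simp only [g]
    rw [← ENNReal.ofReal_mul (by positivity), ← ENNReal.ofReal_mul (by positivity),
      ← ENNReal.ofReal_mul (by positivity)]
    refine ENNReal.ofReal_le_ofReal ?_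
    rw [Real.mul_rpow (abs_nonneg _) (norm_nonneg _)]
    calc _ = |φ y| ^ p * (‖z‖ ^ q * L ^ q * R ^ (-q)) * (|x - y| ^ q / |x - y| ^ (1 + σ)) := by ring
      _ ≤ M ^ p * (‖z‖ ^ q * L ^ q * R ^ (-q)) * |x - y| ^ (q - σ - 1) := by
          gcongr
          · linarith
          · exact hM y
          · exact rpow_div_rpow_le (abs_nonneg _) hq
      _ = _ := by ring
  calc _ ≤ ∫⁻ a, ∫⁻ x in Set.Ioo (-1 : ℝ) 1, ∫⁻ y in Set.Ioo (-1 : ℝ) 1,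
        g x y * (B (a + x • z) + B (a + y • z)) :=
        lintegral_mono fun a => lintegral_mono fun x => lintegral_mono fun y => hpt x y a
    _ = ∫⁻ x in Set.Ioo (-1 : ℝ) 1, ∫⁻ a, ∫⁻ y in Set.Ioo (-1 : ℝ) 1,
        g x y * (B (a + x • z) + B (a + y • z)) := by
        refine lintegral_lintegral_swap (Measurable.aemeasurable ?_)
        exact Measurable.lintegral_prod_right' (f := fun w : (F × ℝ) × ℝ =>
          g w.1.2 w.2 * (B (w.1.1 + w.1.2 • z) + B (w.1.1 + w.2 • z))) (by fun_prop)
    _ = ∫⁻ x in Set.Ioo (-1 : ℝ) 1, ∫⁻ y in Set.Ioo (-1 : ℝ) 1, ∫⁻ a,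
        g x y * (B (a + x • z) + B (a + y • z)) :=
        lintegral_congr fun x =>
          lintegral_lintegral_swap (Measurable.aemeasurable (by fun_prop))
    _ = ∫⁻ x in Set.Ioo (-1 : ℝ) 1, ∫⁻ y in Set.Ioo (-1 : ℝ) 1,
        ENNReal.ofReal (‖z‖ ^ q) * ENNReal.ofReal (M ^ p * L ^ q * R ^ (-q)) *
          (2 * volume (Metric.ball (0 : F) (2 * R))) *
          ENNReal.ofReal (|x - y| ^ (q - σ - 1)) := by
        -- By translation invariance, the integral over a of each indicator is the volume of the
        -- ball, whatever x, y and z are.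
        refine lintegral_congr fun x => lintegral_congr fun y => ?_
        rw [lintegral_const_mul _ (by fun_prop), lintegral_add_left (by fun_prop),
          lintegral_indicator_ball_add, lintegral_indicator_ball_add, ← two_mul, mul_right_comm]
    _ = _ := by
        have hfin : ENNReal.ofReal (‖z‖ ^ q) * ENNReal.ofReal (M ^ p * L ^ q * R ^ (-q)) *
          (2 * volume (Metric.ball (0 : F) (2 * R))) ≠ ⊤ :=
          ENNReal.mul_ne_top (ENNReal.mul_ne_top ENNReal.ofReal_ne_top ENNReal.ofReal_ne_top)
            (ENNReal.mul_ne_top ENNReal.ofNat_ne_top measure_ball_lt_top.ne)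
        simp_rw [lintegral_const_mul' _ _ hfin]
        ring

lemma lintegral_triple_le {α β γ : Type*} [MeasurableSpace α] [MeasurableSpace β]
    [MeasurableSpace γ] {μ : Measure α} {ν : Measure β} {κ : Measure γ} [SFinite ν] [SFinite κ]
    {f g h : α → β → γ → ℝ≥0∞} {A B : ℝ≥0∞} (hA : A ≠ ⊤) (hB : B ≠ ⊤)
    (hg : Measurable fun w : (α × β) × γ => g w.1.1 w.1.2 w.2)
    (hle : ∀ a b c, f a b c ≤ A * g a b c + B * h a b c) :
    ∫⁻ a, ∫⁻ b, ∫⁻ c, f a b c ∂κ ∂ν ∂μ ≤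
      A * ∫⁻ a, ∫⁻ b, ∫⁻ c, g a b c ∂κ ∂ν ∂μ + B * ∫⁻ a, ∫⁻ b, ∫⁻ c, h a b c ∂κ ∂ν ∂μ := by
  have h2 : Measurable fun w : α × β => A * ∫⁻ c, g w.1 w.2 c ∂κ :=
    hg.lintegral_prod_right'.const_mul A
  have h1 : Measurable fun a : α => A * ∫⁻ b, ∫⁻ c, g a b c ∂κ ∂ν :=
    hg.lintegral_prod_right'.lintegral_prod_right'.const_mul A
  rw [← lintegral_const_mul' _ _ hA, ← lintegral_const_mul' _ _ hB, ← lintegral_add_left h1]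
  refine lintegral_mono fun a => ?_
  have h3 : Measurable fun b => A * ∫⁻ c, g a b c ∂κ := h2.comp measurable_prodMk_left
  rw [← lintegral_const_mul' _ _ hA, ← lintegral_const_mul' _ _ hB, ← lintegral_add_left h3]
  refine lintegral_mono fun b => ?_
  have h4 : Measurable fun c => A * g a b c :=
    (hg.comp (measurable_prodMk_left (x := (a, b)))).const_mul A
  rw [← lintegral_const_mul' _ _ hA, ← lintegral_const_mul' _ _ hB, ← lintegral_add_left h4]
  exact lintegral_mono fun c => hle a b c

/-- The energy of the product test function is, up to a vanishing error, the product of the energy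
of the profile and the mass of the cutoff. -/
lemma exists_energy_stripTest_le (m : ℕ) {hn : 1 ≤ m + 1} {p σ θ q : ℝ} (hp : 1 ≤ p)
    (hσq : σ < q) (hq0 : 0 < q) (hqp : q ≤ p) (hq1 : q < 1 + σ) (h0 : 0 < θ) (h1 : θ < 1)
    {φ : ℝ → ℝ} (hφ : IsTest (Set.Ioo (-1 : ℝ) 1) φ) :
    ∃ C : ℝ≥0∞, C ≠ ⊤ ∧ ∀ R : ℝ, 0 < R →
      energy p ((m : ℝ) + 1 + σ) (strip (m + 1) hn) (stripTest m φ R) ≤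
        (ENNReal.ofReal (θ ^ (1 - p)) * (∫⁻ z, ENNReal.ofReal (sliceWeight m σ z)) *
            energy p (1 + σ) (Set.Ioo (-1 : ℝ) 1) φ + C * ENNReal.ofReal (R ^ (-q))) *
          cutoffMass m p R := by
  obtain ⟨M, hM⟩ := hφ.1.continuous.bounded_above_of_compact_support hφ.2.1
  have hM : ∀ x, |φ x| ≤ M := hM
  have hM0 : 0 ≤ M := (abs_nonneg _).trans (hM 0)
  obtain ⟨L, hL0, hL⟩ := exists_cutoff_sub_rpow_le m
  have hφm := hφ.measurable
  set J := ∫⁻ x in Set.Ioo (-1 : ℝ) 1, ∫⁻ y in Set.Ioo (-1 : ℝ) 1,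
        ENNReal.ofReal (|x - y| ^ (q - σ - 1)) with hJ
  have hJtop : J ≠ ⊤ := (lintegral_abs_sub_rpow_lt_top (sub_pos.2 hσq)).ne
  set W := ∫⁻ z, ENNReal.ofReal (sliceWeight m σ z) * ENNReal.ofReal (‖z‖ ^ q) with hW
  have hWtop : W ≠ ⊤ := (lintegral_sliceWeight_mul_norm_lt_top m hq0 hq1).ne
  set A := ENNReal.ofReal (θ ^ (1 - p)) with hA
  set A' := ENNReal.ofReal ((1 - θ) ^ (1 - p)) with hA'
  have hAtop : A ≠ ⊤ := ENNReal.ofReal_ne_top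
  have hAtop' : A' ≠ ⊤ := ENNReal.ofReal_ne_top
  refine ⟨A' * W * (ENNReal.ofReal (M ^ p * L ^ q) * J * (2 * ENNReal.ofReal (2 ^ m))), ?_,
    fun R hR => ?_⟩
  · finiteness
  have hc := (contDiff_cutoff m R).continuous.measurable
  rw [energy_strip m (isTest_stripTest (hn := hn) hφ hR).measurable]
  set e := energy p (1 + σ) (Set.Ioo (-1 : ℝ) 1) φ
  set N := cutoffMass m p R
  have hslice : ∀ z, ∫⁻ a, energy p (1 + σ) (Set.Ioo (-1 : ℝ) 1)
      (fun t => stripTest m φ R (stripCoord m (t, a + t • z))) ≤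
      A * (e * N) + A' * (ENNReal.ofReal (‖z‖ ^ q) * (ENNReal.ofReal (M ^ p * L ^ q * R ^ (-q)) *
        J * (2 * volume (Metric.ball (0 : EuclideanSpace ℝ (Fin m)) (2 * R))))) := by
    intro z
    refine le_trans ?_ (add_le_add (le_of_eq (congrArg (A * ·)
      (lintegral_slice_main (p := p) (σ := σ) (R := R) hφm z)))
      (mul_le_mul_right (lintegral_slice_error_le (σ := σ) hq0 hqp hM hR hL0 (hL hq0 hqp hR) z) A'))
    -- With χ the cutoff, the increment is split as (φ(x) - φ(y)) χ(a + xz) + φ(y) (χ(a + xz) - χ(a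
    -- + yz)).
    refine lintegral_triple_le hAtop hAtop' (by fun_prop) fun a x y => ?_
    simp only [stripTest_stripCoord, Real.norm_eq_abs]
    refine ofReal_rpow_div_le hp h0 h1 ?_ (by positivity)
    refine le_trans (le_of_eq ?_) (abs_add_le _ _)
    congr 1
    ring
  calc _ ≤ ∫⁻ z, ENNReal.ofReal (sliceWeight m σ z) * (A * (e * N) + A' * (ENNReal.ofReal (‖z‖ ^ q) *
        (ENNReal.ofReal (M ^ p * L ^ q * R ^ (-q)) *
        J * (2 * volume (Metric.ball (0 : EuclideanSpace ℝ (Fin m)) (2 * R)))))) :=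
        lintegral_mono fun z => mul_le_mul_right (hslice z) _
    _ = (∫⁻ z, ENNReal.ofReal (sliceWeight m σ z)) * (A * (e * N)) + W * (A' *
        (ENNReal.ofReal (M ^ p * L ^ q * R ^ (-q)) *
        J * (2 * volume (Metric.ball (0 : EuclideanSpace ℝ (Fin m)) (2 * R))))) := by
        rw [hW, ← lintegral_mul_const _ (by fun_prop), ← lintegral_mul_const _ (by fun_prop),
          ← lintegral_add_left (by fun_prop)]
        refine lintegral_congr fun z => ?_
        ring
    _ ≤ (∫⁻ z, ENNReal.ofReal (sliceWeight m σ z)) * (A * (e * N)) + W * (A' *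
        (ENNReal.ofReal (M ^ p * L ^ q * R ^ (-q)) *
        J * (2 * (ENNReal.ofReal (2 ^ m) * N)))) := by
        gcongr
        exact volume_ball_two_mul_le hR
    _ = _ := by
        rw [ENNReal.ofReal_mul (by positivity : 0 ≤ M ^ p * L ^ q)]
        ring

lemma regionalConst_strip_mul_lpIntegral_le (m : ℕ) {hn : 1 ≤ m + 1} {s p : ℝ} (hs0 : 0 < s)
    (hs1 : s < 1) (hp : 1 ≤ p) {φ : ℝ → ℝ} (hφ : IsTest (Set.Ioo (-1 : ℝ) 1) φ) :
    regionalConst s p (strip (m + 1) hn) * lpIntegral p (Set.Ioo (-1 : ℝ) 1) φ ≤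
      seminorm s p (Set.Ioo (-1 : ℝ) 1) φ ^ p := by
  have hσ0 : 0 < s * p := by positivity
  have hσp : s * p < p := by nlinarith
  -- q > sp makes |x - y|^(q-sp-1) integrable, q < 1 + sp makes the q-th moment of the slice weight
  -- finite, and q ≤ p permits the interpolation.
  obtain ⟨q, hσq, hq⟩ := exists_between (lt_min hσp (by linarith : s * p < 1 + s * p))
  have hqp := (lt_min_iff.1 hq).1
  have hq1 := (lt_min_iff.1 hq).2
  have hq0 : 0 < q := hσ0.trans hσq
  refine le_of_forall_weight_mul_le (p := p) fun θ h0 h1 => ?_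
  obtain ⟨C, hC, hE⟩ := exists_energy_stripTest_le m (hn := hn) hp hσq hq0 hqp.le hq1 h0 h1 hφ
  set c := ENNReal.ofReal (normConst (m + 1) s p / 2) with hc
  have hCtop : c * C ≠ ⊤ := ENNReal.mul_ne_top ENNReal.ofReal_ne_top hC
  refine le_of_forall_pos_le_add_mul hCtop fun δ hδ => ?_
  obtain ⟨R, hRδ, hR⟩ : ∃ R : ℝ, ENNReal.ofReal (R ^ (-q)) ≤ δ ∧ 0 < R := by
    have h : Tendsto (fun R : ℝ => ENNReal.ofReal (R ^ (-q))) atTop (𝓝 0) := by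
      simpa using ENNReal.tendsto_ofReal (tendsto_rpow_neg_atTop hq0)
    exact ((h.eventually (ge_mem_nhds hδ)).and (eventually_gt_atTop 0)).exists
  have hN0 : cutoffMass m p R ≠ 0 :=
    ((Metric.measure_ball_pos volume _ hR).trans_le (volume_ball_le_cutoffMass hR)).ne'
  have hNtop : cutoffMass m p R ≠ ⊤ := ((cutoffMass_le hp hR).trans_lt measure_ball_lt_top).ne
  have h := regionalConst_mul_lpIntegral_le (s := s) hp (isTest_stripTest (hn := hn) hφ hR)
  rw [lpIntegral_stripTest hφ hR, seminorm_rpow hp, finrank_euclideanSpace_fin] at h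
  push_cast at h
  rw [seminorm_rpow hp, Module.finrank_self, Nat.cast_one,
    ← normConst_mul_lintegral_sliceWeight m hs0 hs1 hp, ← ENNReal.mul_le_mul_iff_left hN0 hNtop]
  calc _ ≤ c * ((ENNReal.ofReal (θ ^ (1 - p)) * (∫⁻ z, ENNReal.ofReal (sliceWeight m (s * p) z)) *
            energy p (1 + s * p) (Set.Ioo (-1 : ℝ) 1) φ + C * ENNReal.ofReal (R ^ (-q))) *
          cutoffMass m p R) := by
        rw [mul_assoc]
        exact h.trans (mul_le_mul_right (hE R hR) _)
    _ ≤ c * ((ENNReal.ofReal (θ ^ (1 - p)) * (∫⁻ z, ENNReal.ofReal (sliceWeight m (s * p) z)) *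
            energy p (1 + s * p) (Set.Ioo (-1 : ℝ) 1) φ + C * δ) * cutoffMass m p R) := by
        gcongr
    _ = _ := by ring

/-! ### Finiteness and equality -/

lemma exists_isTest_lpIntegral_ne_zero {p : ℝ} (hp : 1 ≤ p) :
    ∃ φ, IsTest (Set.Ioo (-1 : ℝ) 1) φ ∧ lpIntegral p (Set.Ioo (-1 : ℝ) 1) φ ≠ 0 := by
  let f : ContDiffBump (0 : ℝ) := ⟨1 / 4, 1 / 2, by norm_num, by norm_num⟩
  have hf : IsTest (Set.Ioo (-1 : ℝ) 1) f := by
    refine ⟨f.contDiff, f.hasCompactSupport, ?_⟩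
    rw [f.tsupport_eq, Real.closedBall_eq_Icc]
    refine Set.Icc_subset_Ioo ?_ ?_ <;> norm_num [f]
  refine ⟨f, hf, fun h => ?_⟩
  rw [lpIntegral_eq_zero_iff hp hf.measurable.aemeasurable, Filter.EventuallyEq,
    ae_restrict_iff' measurableSet_Ioo] at h
  have h2 : volume (Set.Ioo (-(1 / 4) : ℝ) (1 / 4)) = 0 := by
    refine measure_mono_null (fun x hx => ?_) h
    simp only [Set.mem_compl_iff, Set.mem_ofPred_eq]
    intro hx'
    have h3 := hx' ⟨by linarith [hx.1], by linarith [hx.2]⟩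
    have h4 : f x = 1 := f.one_of_mem_closedBall (by
      rw [Real.closedBall_eq_Icc]
      constructor <;> norm_num [f] <;> linarith [hx.1, hx.2])
    rw [h4] at h3
    exact one_ne_zero h3
  rw [Real.volume_Ioo] at h2
  norm_num at h2

/-- One test function of nonzero mass and finite energy bounds c. Stated for a general c because it
serves the strip constant as well as the interval constant. -/
lemma ne_top_of_forall_isTest {s p : ℝ} (hs1 : s < 1) (hp : 1 ≤ p) {c : ℝ≥0∞}
    (H : ∀ φ, IsTest (Set.Ioo (-1 : ℝ) 1) φ → c * lpIntegral p (Set.Ioo (-1 : ℝ) 1) φ ≤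
      seminorm s p (Set.Ioo (-1 : ℝ) 1) φ ^ p) : c ≠ ⊤ := by
  obtain ⟨φ, hφ, hne⟩ := exists_isTest_lpIntegral_ne_zero hp
  rintro rfl
  have h := H φ hφ
  rw [ENNReal.top_mul hne, seminorm_rpow hp, Module.finrank_self, Nat.cast_one, top_le_iff] at h
  exact (ENNReal.mul_lt_top ENNReal.ofReal_lt_top
    (hφ.energy_lt_top (σ := s * p) hp (by nlinarith))).ne h

lemma regionalConst_Ioo_ne_top {s p : ℝ} (hs1 : s < 1) (hp : 1 ≤ p) :
    regionalConst s p (Set.Ioo (-1 : ℝ) 1) ≠ ⊤ :=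
  ne_top_of_forall_isTest hs1 hp fun _ hφ => regionalConst_mul_lpIntegral_le hp hφ

lemma regionalConst_strip_eq (m : ℕ) {hn : 1 ≤ m + 1} {s p : ℝ} (hs0 : 0 < s) (hs1 : s < 1)
    (hp : 1 ≤ p) :
    regionalConst s p (strip (m + 1) hn) = regionalConst s p (Set.Ioo (-1 : ℝ) 1) := by
  have H := fun φ hφ => regionalConst_strip_mul_lpIntegral_le m (hn := hn) hs0 hs1 hp (φ := φ) hφ
  exact le_antisymm (le_regionalConst_of_test hp (ne_top_of_forall_isTest hs1 hp H) H)
    (regionalConst_Ioo_le_strip m hs0 hs1 hp (regionalConst_Ioo_ne_top hs1 hp))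

/-! ### A fractional Hardy inequality on `(-1,1)` -/

/-- The one-sided kernel `(x + 1) ^ (-1 - σ)` on `y < x`. -/
noncomputable def hardyKernel (σ x y : ℝ) : ℝ≥0∞ :=
  (Set.Iio x).indicator (fun _ => ENNReal.ofReal ((x + 1) ^ (-1 - σ))) y

lemma measurable_hardyKernel (σ : ℝ) :
    Measurable fun w : ℝ × ℝ => hardyKernel σ w.1 w.2 := by
  have : (fun w : ℝ × ℝ => hardyKernel σ w.1 w.2) = {w : ℝ × ℝ | w.2 < w.1}.indicator
      fun w => ENNReal.ofReal ((w.1 + 1) ^ (-1 - σ)) := by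
    ext w
    simp only [hardyKernel, Set.indicator, Set.mem_Iio, Set.mem_ofPred_eq]
  rw [this]
  exact Measurable.indicator (by fun_prop) (measurableSet_lt measurable_snd measurable_fst)

lemma lintegral_hardyKernel_snd (σ : ℝ) {x : ℝ} (hx : x ∈ Set.Ioo (-1 : ℝ) 1) :
    ∫⁻ y in Set.Ioo (-1 : ℝ) 1, hardyKernel σ x y = ENNReal.ofReal ((x + 1) ^ (-σ)) := by
  have hx0 : 0 < x + 1 := by linarith [hx.1]
  have hset : Set.Iio x ∩ Set.Ioo (-1 : ℝ) 1 = Set.Ioo (-1) x := by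
    ext y
    simp only [Set.mem_inter_iff, Set.mem_Iio, Set.mem_Ioo]
    constructor
    · rintro ⟨h1, h2, h3⟩
      exact ⟨h2, h1⟩
    · rintro ⟨h1, h2⟩
      exact ⟨h2, h1, h2.trans hx.2⟩
  unfold hardyKernel
  rw [lintegral_indicator_const measurableSet_Iio, Measure.restrict_apply measurableSet_Iio, hset,
    Real.volume_Ioo, ← ENNReal.ofReal_mul (by positivity)]
  congr 1
  rw [show -σ = (-1 - σ) + 1 by ring, Real.rpow_add hx0 (-1 - σ) 1, Real.rpow_one]
  ring

lemma lintegral_hardyKernel_fst_le {σ : ℝ} (hσ : 0 < σ) {y : ℝ} (hy : y ∈ Set.Ioo (-1 : ℝ) 1) :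
    ∫⁻ x in Set.Ioo (-1 : ℝ) 1, hardyKernel σ x y ≤ ENNReal.ofReal ((y + 1) ^ (-σ) / σ) := by
  have hy0 : 0 < y + 1 := by linarith [hy.1]
  have hint := integrableOn_Ioi_rpow_of_lt (by linarith : -1 - σ < -1) hy0
  have hval := integral_Ioi_rpow_of_lt (by linarith : -1 - σ < -1) hy0
  calc _ ≤ ∫⁻ x, hardyKernel σ x y := setLIntegral_le_lintegral _ _
    _ = ∫⁻ x, (Set.Ioi (y + 1)).indicator (fun t => ENNReal.ofReal (t ^ (-1 - σ))) (x + 1) := by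
        refine lintegral_congr fun x => ?_
        simp only [hardyKernel, Set.indicator, Set.mem_Iio, Set.mem_Ioi, add_lt_add_iff_right]
    _ = ∫⁻ t in Set.Ioi (y + 1), ENNReal.ofReal (t ^ (-1 - σ)) := by
        rw [lintegral_add_right_eq_self
          ((Set.Ioi (y + 1)).indicator fun t => ENNReal.ofReal (t ^ (-1 - σ))) 1,
          lintegral_indicator measurableSet_Ioi]
    _ ≤ _ := by
        rw [← ofReal_integral_eq_lintegral_ofReal hint, hval]
        · refine ENNReal.ofReal_le_ofReal (le_of_eq ?_)
          rw [show -1 - σ + 1 = -σ by ring, neg_div_neg_eq]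
        · filter_upwards [ae_restrict_mem measurableSet_Ioi] with t ht
          have : 0 < t := hy0.trans ht
          positivity

/-- For -1 < y < x one has x - y ≤ x + 1, so the Gagliardo kernel dominates the Hardy kernel. -/
lemma hardyKernel_mul_le {σ p a x y : ℝ} (hσ : 0 < σ) (hy : y ∈ Set.Ioo (-1 : ℝ) 1) :
    hardyKernel σ x y * ENNReal.ofReal (|a| ^ p) ≤ ENNReal.ofReal (|a| ^ p / |x - y| ^ (1 + σ)) := by
  unfold hardyKernel
  by_cases hxy : y < x
  · rw [Set.indicator_of_mem (Set.mem_Iio.2 hxy), ← ENNReal.ofReal_mul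
      (Real.rpow_nonneg (by linarith [hy.1]) _)]
    refine ENNReal.ofReal_le_ofReal ?_
    rw [abs_of_pos (sub_pos.2 hxy), div_eq_inv_mul, ← Real.rpow_neg (by linarith), neg_add,
      ← sub_eq_add_neg]
    refine mul_le_mul_of_nonneg_right ?_ (by positivity)
    exact Real.rpow_le_rpow_of_nonpos (by linarith) (by linarith [hy.1]) (by linarith)
  · rw [Set.indicator_of_notMem (by simpa using hxy), zero_mul]
    exact zero_le

/-- The weighted mass `∫ |φ|^p (x + 1)^{-σ}`. -/
noncomputable def hardyMass (p σ : ℝ) (φ : ℝ → ℝ) : ℝ≥0∞ :=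
  ∫⁻ x in Set.Ioo (-1 : ℝ) 1, ENNReal.ofReal ((x + 1) ^ (-σ)) * ENNReal.ofReal (|φ x| ^ p)

/-- The support stays away from -1. Finiteness is what allows the Hardy mass to be cancelled from
both sides of `hardyMass_le`. -/
lemma hardyMass_lt_top {p σ : ℝ} (hp : 1 ≤ p) (hσ : 0 < σ) {φ : ℝ → ℝ}
    (hφ : IsTest (Set.Ioo (-1 : ℝ) 1) φ) : hardyMass p σ φ < ⊤ := by
  obtain ⟨M, hM⟩ := hφ.1.continuous.bounded_above_of_compact_support hφ.2.1
  obtain ⟨δ, hδ, hsub⟩ := hφ.2.1.isCompact.exists_thickening_subset_open isOpen_Ioo hφ.2.2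
  have hle : ∀ x, ENNReal.ofReal ((x + 1) ^ (-σ)) * ENNReal.ofReal (|φ x| ^ p) ≤
      ENNReal.ofReal ((δ / 2) ^ (-σ)) * ENNReal.ofReal (M ^ p) := by
    intro x
    by_cases hx : φ x = 0
    · rw [hx, abs_zero, Real.zero_rpow (by linarith), ENNReal.ofReal_zero, mul_zero]
      exact zero_le
    have hmem : x - δ / 2 ∈ Metric.thickening δ (tsupport φ) := by
      rw [Metric.mem_thickening_iff]
      refine ⟨x, subset_tsupport _ hx, ?_⟩
      rw [Real.dist_eq, sub_sub_cancel_left, abs_neg, abs_of_pos (by linarith)]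
      linarith
    have h1 := (hsub hmem).1
    refine mul_le_mul' (ENNReal.ofReal_le_ofReal ?_) (ENNReal.ofReal_le_ofReal ?_)
    · exact Real.rpow_le_rpow_of_nonpos (by linarith) (by linarith) (by linarith)
    · exact Real.rpow_le_rpow (abs_nonneg _) (hM x) (by linarith)
  refine lt_of_le_of_lt (lintegral_mono hle) ?_
  rw [lintegral_const]
  exact ENNReal.mul_lt_top (ENNReal.mul_lt_top ENNReal.ofReal_lt_top ENNReal.ofReal_lt_top)
    (by simp)

/-- Integrate the weighted bound of |φ(x)|^p by |φ(y)|^p and |φ(x) - φ(y)|^p against the Hardy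
kernel. Integrating the kernel in y gives (x + 1)^(-σ), while integrating it in x gives at most (y +
1)^(-σ)/σ. For σ > 1 the factor 1/σ leaves room to absorb the first term on the right. -/
lemma hardyMass_le {p σ θ : ℝ} (hp : 1 ≤ p) (hσ : 0 < σ) (h0 : 0 < θ) (h1 : θ < 1) {φ : ℝ → ℝ}
    (hφ : Measurable φ) :
    hardyMass p σ φ ≤ ENNReal.ofReal (θ ^ (1 - p) / σ) * hardyMass p σ φ +
      ENNReal.ofReal ((1 - θ) ^ (1 - p)) * energy p (1 + σ) (Set.Ioo (-1 : ℝ) 1) φ := by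
  have hk := measurable_hardyKernel σ
  set I := Set.Ioo (-1 : ℝ) 1 with hI
  set A := ENNReal.ofReal (θ ^ (1 - p)) with hA
  set B := ENNReal.ofReal ((1 - θ) ^ (1 - p)) with hB
  have hpt : ∀ x y, hardyKernel σ x y * ENNReal.ofReal (|φ x| ^ p) ≤
      A * (hardyKernel σ x y * ENNReal.ofReal (|φ y| ^ p)) +
        B * (hardyKernel σ x y * ENNReal.ofReal (|φ x - φ y| ^ p)) := by
    intro x y
    have h := ofReal_rpow_div_le (a := φ x) (b := φ y) (c := φ x - φ y) (k := 1) hp h0 h1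
      (by simpa using abs_add_le (φ y) (φ x - φ y)) zero_le_one
    simp only [div_one] at h
    refine (mul_le_mul_right h _).trans_eq ?_
    ring
  have hm1 : Measurable fun w : ℝ × ℝ => A * (hardyKernel σ w.1 w.2 *
      ENNReal.ofReal (|φ w.2| ^ p)) := by fun_prop
  have hswap : ∫⁻ x in I, ∫⁻ y in I, hardyKernel σ x y * ENNReal.ofReal (|φ y| ^ p) ≤
      ENNReal.ofReal σ⁻¹ * hardyMass p σ φ := by
    rw [lintegral_lintegral_swap (Measurable.aemeasurable (by fun_prop)), hardyMass,
      ← lintegral_const_mul' _ _ ENNReal.ofReal_ne_top]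
    refine setLIntegral_mono' measurableSet_Ioo fun y hy => ?_
    rw [lintegral_mul_const' _ _ ENNReal.ofReal_ne_top, ← mul_assoc]
    refine mul_le_mul_left ((lintegral_hardyKernel_fst_le hσ hy).trans_eq ?_) _
    rw [← ENNReal.ofReal_mul (by positivity), div_eq_inv_mul]
  calc hardyMass p σ φ = ∫⁻ x in I, ∫⁻ y in I, hardyKernel σ x y * ENNReal.ofReal (|φ x| ^ p) := by
        refine setLIntegral_congr_fun measurableSet_Ioo fun x hx => ?_
        rw [lintegral_mul_const' _ _ ENNReal.ofReal_ne_top, lintegral_hardyKernel_snd σ hx]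
    _ ≤ ∫⁻ x in I, ∫⁻ y in I, (A * (hardyKernel σ x y * ENNReal.ofReal (|φ y| ^ p)) +
        B * (hardyKernel σ x y * ENNReal.ofReal (|φ x - φ y| ^ p))) :=
        lintegral_mono fun x => lintegral_mono fun y => hpt x y
    _ = A * (∫⁻ x in I, ∫⁻ y in I, hardyKernel σ x y * ENNReal.ofReal (|φ y| ^ p)) +
        B * ∫⁻ x in I, ∫⁻ y in I, hardyKernel σ x y * ENNReal.ofReal (|φ x - φ y| ^ p) := by
        have hin : ∀ x, ∫⁻ y in I, (A * (hardyKernel σ x y * ENNReal.ofReal (|φ y| ^ p)) +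
            B * (hardyKernel σ x y * ENNReal.ofReal (|φ x - φ y| ^ p))) =
            A * (∫⁻ y in I, hardyKernel σ x y * ENNReal.ofReal (|φ y| ^ p)) +
            B * ∫⁻ y in I, hardyKernel σ x y * ENNReal.ofReal (|φ x - φ y| ^ p) := fun x => by
          rw [← lintegral_const_mul' _ _ ENNReal.ofReal_ne_top,
            ← lintegral_const_mul' _ _ ENNReal.ofReal_ne_top]
          exact lintegral_add_left (hm1.comp measurable_prodMk_left) _
        rw [lintegral_congr hin, lintegral_add_left, lintegral_const_mul' _ _ ENNReal.ofReal_ne_top,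
          lintegral_const_mul' _ _ ENNReal.ofReal_ne_top]
        exact Measurable.const_mul (Measurable.lintegral_prod_right' (f := fun w : ℝ × ℝ =>
          hardyKernel σ w.1 w.2 * ENNReal.ofReal (|φ w.2| ^ p)) (by fun_prop)) A
    _ ≤ A * (ENNReal.ofReal σ⁻¹ * hardyMass p σ φ) + B * energy p (1 + σ) I φ := by
        refine add_le_add (mul_le_mul_right hswap _) (mul_le_mul_right ?_ _)
        refine lintegral_mono fun x => setLIntegral_mono' measurableSet_Ioo fun y hy => ?_
        exact hardyKernel_mul_le hσ hy
    _ = _ := by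
        rw [← mul_assoc, hA, ← ENNReal.ofReal_mul (by positivity), div_eq_mul_inv]

lemma mul_lpIntegral_le_hardyMass {p σ : ℝ} (hσ : 0 < σ) (φ : ℝ → ℝ) :
    ENNReal.ofReal (2 ^ (-σ)) * lpIntegral p (Set.Ioo (-1 : ℝ) 1) φ ≤ hardyMass p σ φ := by
  unfold lpIntegral hardyMass
  rw [← lintegral_const_mul' _ _ ENNReal.ofReal_ne_top]
  refine setLIntegral_mono' measurableSet_Ioo fun x hx => ?_
  refine mul_le_mul_left (ENNReal.ofReal_le_ofReal ?_) _
  exact Real.rpow_le_rpow_of_nonpos (by linarith [hx.1]) (by linarith [hx.2]) (by linarith)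

lemma regionalConst_Ioo_pos {s p : ℝ} (hs0 : 0 < s) (hs1 : s < 1) (hp : 1 ≤ p)
    (hsp : 1 / p < s) : 0 < regionalConst s p (Set.Ioo (-1 : ℝ) 1) := by
  have hσ1 : 1 < s * p := by rwa [div_lt_iff₀ (by linarith)] at hsp
  have hσ0 : 0 < s * p := by linarith
  -- θ is taken so close to 1 that the absorption coefficient θ^(1-p)/(sp) is below 1.
  obtain ⟨θ, hθ, h0, h1⟩ : ∃ θ : ℝ, θ ^ (1 - p) < s * p ∧ 0 < θ ∧ θ < 1 := by
    have h2 : Tendsto (fun θ : ℝ => θ ^ (1 - p)) (𝓝[<] 1) (𝓝 1) := by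
      have := (Real.continuousAt_rpow_const 1 (1 - p) (Or.inl one_ne_zero)).tendsto
      rw [Real.one_rpow] at this
      exact this.mono_left nhdsWithin_le_nhds
    exact ((h2.eventually (gt_mem_nhds hσ1)).and (Ioo_mem_nhdsLT zero_lt_one)).exists
  have h1' : 0 < 1 - θ := by linarith
  set κ := θ ^ (1 - p) / (s * p) with hκ
  have hκ0 : 0 ≤ κ := by positivity
  have hκ1 : 0 < 1 - κ := by
    rw [sub_pos, hκ, div_lt_one hσ0]
    exact hθ
  have hC := normConst_pos (n := 1) hs0 hs1 hp
  set b := (1 - θ) ^ (1 - p) with hb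
  have hb0 : 0 < b := by positivity
  set c := normConst 1 s p / 2 * b⁻¹ * (1 - κ) * 2 ^ (-(s * p)) with hc
  have hc0 : 0 < c := by positivity
  refine lt_of_lt_of_le (ENNReal.ofReal_pos.2 hc0)
    (le_regionalConst_of_test hp ENNReal.ofReal_ne_top fun φ hφ => ?_)
  have hJ := (hardyMass_lt_top hp hσ0 hφ).ne
  have hle := hardyMass_le hp hσ0 h0 h1 hφ.measurable
  have hsub : ENNReal.ofReal (1 - κ) * hardyMass p (s * p) φ ≤
      ENNReal.ofReal b * energy p (1 + s * p) (Set.Ioo (-1 : ℝ) 1) φ := by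
    have hsplit : hardyMass p (s * p) φ = ENNReal.ofReal κ * hardyMass p (s * p) φ +
        ENNReal.ofReal (1 - κ) * hardyMass p (s * p) φ := by
      rw [← add_mul, ← ENNReal.ofReal_add hκ0 hκ1.le, add_sub_cancel, ENNReal.ofReal_one, one_mul]
    nth_rw 1 [hsplit] at hle
    exact (ENNReal.add_le_add_iff_left (ENNReal.mul_ne_top ENNReal.ofReal_ne_top hJ)).1 hle
  rw [seminorm_rpow hp, Module.finrank_self, Nat.cast_one]
  set N := ENNReal.ofReal (normConst 1 s p / 2)
  calc _ = N * (ENNReal.ofReal b⁻¹ * (ENNReal.ofReal (1 - κ) * (ENNReal.ofReal (2 ^ (-(s * p))) *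
        lpIntegral p (Set.Ioo (-1 : ℝ) 1) φ))) := by
        rw [hc, ENNReal.ofReal_mul (by positivity), ENNReal.ofReal_mul (by positivity),
          ENNReal.ofReal_mul (by positivity)]
        ring
    _ ≤ N * (ENNReal.ofReal b⁻¹ * (ENNReal.ofReal b *
        energy p (1 + s * p) (Set.Ioo (-1 : ℝ) 1) φ)) := by
        refine mul_le_mul_right (mul_le_mul_right ?_ _) _
        exact (mul_le_mul_right (mul_lpIntegral_le_hardyMass hσ0 φ) _).trans hsub
    _ = _ := by
        rw [← mul_assoc (ENNReal.ofReal b⁻¹), ← ENNReal.ofReal_mul (by positivity),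
          inv_mul_cancel₀ hb0.ne', ENNReal.ofReal_one, one_mul]

/-! ### Logarithmic cutoffs -/

lemma exists_lipschitz_smoothTransition :
    ∃ K : ℝ, 0 ≤ K ∧ ∀ x y, |Real.smoothTransition x - Real.smoothTransition y| ≤ K * |x - y| := by
  obtain ⟨K, hK⟩ := (Real.smoothTransition.contDiff (n := 1)).locallyLipschitz.locallyLipschitzOn
    (s := Set.Icc (0 : ℝ) 1) |>.exists_lipschitzOnWith_of_compact isCompact_Icc
  refine ⟨K, K.2, fun x y => ?_⟩
  rw [← Real.smoothTransition.projIcc (x := x), ← Real.smoothTransition.projIcc (x := y)]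
  have h := hK.dist_le_mul _ (Set.projIcc (0 : ℝ) 1 zero_le_one x).2 _
    (Set.projIcc (0 : ℝ) 1 zero_le_one y).2
  rw [Real.dist_eq, Real.dist_eq] at h
  exact h.trans (mul_le_mul_of_nonneg_left (Set.abs_projIcc_sub_projIcc zero_le_one) K.2)

/-- The logarithmic cutoff: `0` for `r ≤ e^{-2L}`, and `1` for `r ≥ e^{-L}`. -/
noncomputable def logCutoff (L r : ℝ) : ℝ :=
  (Set.Ioi (0 : ℝ)).indicator (fun r => Real.smoothTransition (2 + Real.log r / L)) r

lemma logCutoff_of_pos (L : ℝ) {r : ℝ} (hr : 0 < r) :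
    logCutoff L r = Real.smoothTransition (2 + Real.log r / L) :=
  Set.indicator_of_mem (Set.mem_Ioi.2 hr) _

lemma logCutoff_nonneg (L r : ℝ) : 0 ≤ logCutoff L r :=
  Set.indicator_nonneg (fun _ _ => Real.smoothTransition.nonneg _) r

lemma logCutoff_le_one (L r : ℝ) : logCutoff L r ≤ 1 :=
  Set.indicator_apply_le' (fun _ => Real.smoothTransition.le_one _) fun _ => zero_le_one

lemma logCutoff_eq_zero {L r : ℝ} (hL : 0 < L) (hr : r ≤ Real.exp (-(2 * L))) :
    logCutoff L r = 0 := by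
  rcases le_or_gt r 0 with h | h
  · exact Set.indicator_of_notMem (by simpa using h) _
  · rw [logCutoff_of_pos L h]
    refine Real.smoothTransition.zero_of_nonpos ?_
    have h1 := (Real.log_le_iff_le_exp h).2 hr
    have h2 : Real.log r / L ≤ -2 := by
      rw [div_le_iff₀ hL]
      linarith
    linarith

lemma logCutoff_eq_one {L r : ℝ} (hL : 0 < L) (hr : Real.exp (-L) ≤ r) : logCutoff L r = 1 := by
  have h : 0 < r := (Real.exp_pos _).trans_le hr
  rw [logCutoff_of_pos L h]
  refine Real.smoothTransition.one_of_one_le ?_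
  have h1 := (Real.le_log_iff_exp_le h).2 hr
  have h2 : -1 ≤ Real.log r / L := by
    rw [le_div_iff₀ hL]
    linarith
  linarith

lemma contDiff_logCutoff {L : ℝ} (hL : 0 < L) : ContDiff ℝ (⊤ : ℕ∞) (logCutoff L) := by
  rw [contDiff_iff_contDiffAt]
  intro r
  rcases lt_or_ge r (Real.exp (-(2 * L))) with h | h
  · refine (contDiffAt_const (c := (0 : ℝ))).congr_of_eventuallyEq ?_
    filter_upwards [Iio_mem_nhds h] with t ht using logCutoff_eq_zero hL (le_of_lt ht)
  · have hr : 0 < r := (Real.exp_pos _).trans_le h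
    have h1 : ContDiffAt ℝ (⊤ : ℕ∞) (fun r => Real.smoothTransition (2 + Real.log r / L)) r :=
      Real.smoothTransition.contDiff.contDiffAt.comp r
        (contDiffAt_const.add ((Real.contDiffAt_log.2 hr.ne').div_const L))
    refine h1.congr_of_eventuallyEq ?_
    filter_upwards [Ioi_mem_nhds hr] with t ht using logCutoff_of_pos L ht

/-! ### Energy of the logarithmic cutoff -/

/-- With ρ = r/t, log ρ ≤ (ρ^a - 1)/a, and ρ^(a-1) ≤ 1 gives ρ^a - 1 ≤ (1 - 1/ρ)ρ^a. The factor r -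
t controls the diagonal, at the price of only a small power singularity at t = 0. -/
lemma log_div_le {a r t : ℝ} (ha0 : 0 < a) (ha1 : a ≤ 1) (ht : 0 < t) (htr : t < r) :
    Real.log r - Real.log t ≤ (r - t) / r * (r / t) ^ a / a := by
  have hr : 0 < r := ht.trans htr
  have hx : 0 < r / t := by positivity
  have hx1 : 1 ≤ r / t := (one_le_div ht).2 htr.le
  have h1 : a * Real.log (r / t) ≤ (r / t) ^ a - 1 := by
    rw [← Real.log_rpow hx]
    exact Real.log_le_sub_one_of_pos (by positivity)
  have h2 : (r / t) ^ a ≤ r / t := by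
    simpa using Real.rpow_le_rpow_of_exponent_le hx1 ha1
  have h3 : t / r * (r / t) ^ a ≤ 1 := by
    calc _ ≤ t / r * (r / t) := by gcongr
      _ = 1 := by field_simp
  rw [← Real.log_div hr.ne' ht.ne', le_div_iff₀ ha0, sub_div, div_self hr.ne']
  linarith

lemma lintegral_Ioo_rpow {b r : ℝ} (hb : 0 < b) (hr : 0 < r) :
    ∫⁻ t in Set.Ioo 0 r, ENNReal.ofReal (t ^ (b - 1)) = ENNReal.ofReal (r ^ b / b) := by
  have hi := intervalIntegral.intervalIntegrable_rpow' (a := 0) (b := r)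
    (by linarith : -1 < b - 1)
  have hv := integral_rpow (a := 0) (b := r) (r := b - 1) (Or.inl (by linarith))
  rw [sub_add_cancel, Real.zero_rpow hb.ne', sub_zero, intervalIntegral.integral_of_le hr.le,
    integral_Ioc_eq_integral_Ioo] at hv
  rw [intervalIntegrable_iff_integrableOn_Ioo_of_le hr.le] at hi
  rw [← ofReal_integral_eq_lintegral_ofReal hi, hv]
  filter_upwards [ae_restrict_mem measurableSet_Ioo] with t ht
  have : 0 < t := ht.1
  positivity

lemma lintegral_Ioo_sub_left {r : ℝ} (f : ℝ → ℝ≥0∞) :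
    ∫⁻ t in Set.Ioo 0 r, f (r - t) = ∫⁻ t in Set.Ioo 0 r, f t := by
  rw [← lintegral_indicator measurableSet_Ioo, ← lintegral_indicator measurableSet_Ioo,
    ← lintegral_sub_left_eq_self ((Set.Ioo 0 r).indicator f) r]
  refine lintegral_congr fun t => ?_
  have : r - t ∈ Set.Ioo 0 r ↔ t ∈ Set.Ioo 0 r := by
    simp only [Set.mem_Ioo]
    constructor <;> rintro ⟨h1, h2⟩ <;> constructor <;> linarith
  by_cases h : t ∈ Set.Ioo 0 r
  · rw [Set.indicator_of_mem h, Set.indicator_of_mem (this.2 h)]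
  · rw [Set.indicator_of_notMem h, Set.indicator_of_notMem (fun h' => h (this.1 h'))]

/-- An upper bound for a Beta-type integral. -/
lemma exists_lintegral_beta_le {c : ℝ} (hc : 0 < c) : ∃ B : ℝ, 0 ≤ B ∧ ∀ r : ℝ, 0 < r →
    ∫⁻ t in Set.Ioo 0 r, ENNReal.ofReal ((r / t) ^ (1 / 2 : ℝ) * (r - t) ^ (c - 1)) ≤
      ENNReal.ofReal (B * r ^ c) := by
  set D : ℝ := 1 + (1 / 2) ^ (c - 1) with hD
  have hD0 : 0 ≤ D := by positivity
  refine ⟨2 * D + 2 / c, by positivity, fun r hr => ?_⟩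
  have hpt : ∀ t ∈ Set.Ioo 0 r, ENNReal.ofReal ((r / t) ^ (1 / 2 : ℝ) * (r - t) ^ (c - 1)) ≤
      ENNReal.ofReal (D * r ^ (c - 1) * r ^ (1 / 2 : ℝ)) * ENNReal.ofReal (t ^ ((1 / 2 : ℝ) - 1)) +
        ENNReal.ofReal 2 * ENNReal.ofReal ((r - t) ^ (c - 1)) := by
    rintro t ⟨ht, htr⟩
    have hrt : 0 < r - t := sub_pos.2 htr
    rw [← ENNReal.ofReal_mul (by positivity), ← ENNReal.ofReal_mul (by positivity),
      ← ENNReal.ofReal_add (by positivity) (by positivity)]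
    refine ENNReal.ofReal_le_ofReal ?_
    -- For t ≤ r/2 the factor (r - t)^(c-1) is comparable to r^(c-1); the two terms of `D` cover c ≥
    -- 1 and c ≤ 1. For t > r/2 the factor (r/t)^(1/2) is at most 2.
    rcases le_or_gt t (r / 2) with h | h
    · have h1 : (r - t) ^ (c - 1) ≤ D * r ^ (c - 1) := by
        have hr1 : 0 < r ^ (c - 1) := by positivity
        rw [hD, add_mul, one_mul, ← Real.mul_rpow (by norm_num) hr.le]
        have h2 : 0 ≤ (1 / 2 * r) ^ (c - 1) := by positivity
        rcases le_total 1 c with h3 | h3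
        · have := Real.rpow_le_rpow hrt.le (by linarith : r - t ≤ r) (by linarith : 0 ≤ c - 1)
          linarith
        · have := Real.rpow_le_rpow_of_nonpos (by positivity) (by linarith : 1 / 2 * r ≤ r - t)
            (by linarith : c - 1 ≤ 0)
          linarith
      have h2 : (r / t) ^ (1 / 2 : ℝ) = r ^ (1 / 2 : ℝ) * t ^ ((1 / 2 : ℝ) - 1) := by
        rw [Real.div_rpow hr.le ht.le, show (1 / 2 : ℝ) - 1 = -(1 / 2) by norm_num,
          Real.rpow_neg ht.le, div_eq_mul_inv]
      calc _ ≤ (r / t) ^ (1 / 2 : ℝ) * (D * r ^ (c - 1)) := by gcongr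
        _ = D * r ^ (c - 1) * r ^ (1 / 2 : ℝ) * t ^ ((1 / 2 : ℝ) - 1) := by rw [h2]; ring
        _ ≤ _ := le_add_of_nonneg_right (by positivity)
    · have h1 : (r / t) ^ (1 / 2 : ℝ) ≤ 2 := by
        have h2 : r / t ≤ 2 := by
          rw [div_le_iff₀ ht]
          linarith
        have h3 : 1 ≤ r / t := (one_le_div ht).2 htr.le
        calc _ ≤ (r / t) ^ (1 : ℝ) := Real.rpow_le_rpow_of_exponent_le h3 (by norm_num)
          _ ≤ 2 := by rwa [Real.rpow_one]
      calc _ ≤ 2 * (r - t) ^ (c - 1) := by gcongr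
        _ ≤ _ := le_add_of_nonneg_left (by positivity)
  refine (setLIntegral_mono' measurableSet_Ioo hpt).trans ?_
  rw [lintegral_add_left (by fun_prop), lintegral_const_mul' _ _ ENNReal.ofReal_ne_top,
    lintegral_const_mul' _ _ ENNReal.ofReal_ne_top,
    lintegral_Ioo_sub_left (fun t => ENNReal.ofReal (t ^ (c - 1))), lintegral_Ioo_rpow hc hr,
    lintegral_Ioo_rpow (by norm_num) hr, ← ENNReal.ofReal_mul (by positivity),
    ← ENNReal.ofReal_mul (by positivity), ← ENNReal.ofReal_add (by positivity) (by positivity)]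
  refine ENNReal.ofReal_le_ofReal (le_of_eq ?_)
  have h1 : r ^ c = r ^ (c - 1) * (r ^ (1 / 2 : ℝ) * r ^ (1 / 2 : ℝ)) := by
    rw [← Real.rpow_add hr, ← Real.rpow_add hr]
    congr 1
    ring
  rw [h1]
  field_simp

lemma energy_Ioo_le_two_mul {p α : ℝ} (hp : 1 ≤ p) {v : ℝ → ℝ} (hv : Measurable v) :
    energy p α (Set.Ioo (0 : ℝ) 2) v ≤ 2 * ∫⁻ r in Set.Ioo (0 : ℝ) 2, ∫⁻ t in Set.Ioo 0 r,
      ENNReal.ofReal (|v r - v t| ^ p / |r - t| ^ α) := by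
  let f : ℝ → ℝ → ℝ≥0∞ := fun r t => ENNReal.ofReal (|v r - v t| ^ p / |r - t| ^ α)
  have hf : Measurable fun w : ℝ × ℝ => f w.1 w.2 := by fun_prop
  have hsymm : ∀ r t, f r t = f t r := fun r t => by
    simp only [f, abs_sub_comm (v r), abs_sub_comm r]
  let g : ℝ → ℝ → ℝ≥0∞ := fun r t => (Set.Iio r).indicator (f r) t
  have hg : Measurable fun w : ℝ × ℝ => g w.1 w.2 := by
    have : (fun w : ℝ × ℝ => g w.1 w.2) = {w : ℝ × ℝ | w.2 < w.1}.indicator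
        fun w => f w.1 w.2 := by
      ext w
      simp only [g, Set.indicator, Set.mem_Iio, Set.mem_ofPred_eq]
    rw [this]
    exact hf.indicator (measurableSet_lt measurable_snd measurable_fst)
  have hle : ∀ r t, f r t ≤ g r t + g t r := by
    intro r t
    simp only [g]
    rcases lt_trichotomy t r with h | rfl | h
    · rw [Set.indicator_of_mem (Set.mem_Iio.2 h)]
      exact le_self_add
    · simp [f, Real.zero_rpow (by linarith : p ≠ 0)]
    · rw [Set.indicator_of_mem (Set.mem_Iio.2 h), hsymm]
      exact le_add_self
  have hgI : ∀ r ∈ Set.Ioo (0 : ℝ) 2, ∫⁻ t in Set.Ioo (0 : ℝ) 2, g r t =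
      ∫⁻ t in Set.Ioo 0 r, f r t := by
    intro r hr
    have : Set.Iio r ∩ Set.Ioo (0 : ℝ) 2 = Set.Ioo 0 r := by
      ext t
      simp only [Set.mem_inter_iff, Set.mem_Iio, Set.mem_Ioo]
      constructor
      · rintro ⟨h1, h2, h3⟩
        exact ⟨h2, h1⟩
      · rintro ⟨h1, h2⟩
        exact ⟨h2, h1, h2.trans hr.2⟩
    simp only [g]
    rw [lintegral_indicator measurableSet_Iio, Measure.restrict_restrict measurableSet_Iio, this]
  calc energy p α (Set.Ioo (0 : ℝ) 2) v
      ≤ ∫⁻ r in Set.Ioo (0 : ℝ) 2, ∫⁻ t in Set.Ioo (0 : ℝ) 2, (g r t + g t r) :=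
        lintegral_mono fun r => lintegral_mono fun t => hle r t
    _ = (∫⁻ r in Set.Ioo (0 : ℝ) 2, ∫⁻ t in Set.Ioo (0 : ℝ) 2, g r t) +
        ∫⁻ r in Set.Ioo (0 : ℝ) 2, ∫⁻ t in Set.Ioo (0 : ℝ) 2, g t r := by
        rw [← lintegral_add_left hg.lintegral_prod_right']
        exact lintegral_congr fun r => lintegral_add_left (hg.comp measurable_prodMk_left) _
    _ = 2 * ∫⁻ r in Set.Ioo (0 : ℝ) 2, ∫⁻ t in Set.Ioo (0 : ℝ) 2, g r t := by
        rw [lintegral_lintegral_swap (f := fun r t => g t r)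
          (hg.comp measurable_swap).aemeasurable, two_mul]
    _ = _ := by
        congr 1
        exact setLIntegral_congr_fun measurableSet_Ioo hgI

lemma exists_logCutoff_sub_rpow_le {p σ : ℝ} (hp : 1 ≤ p) : ∃ A : ℝ, 0 ≤ A ∧
    ∀ L r t : ℝ, 0 < L → 0 < t → t < r →
      |logCutoff L r - logCutoff L t| ^ p / |r - t| ^ (1 + σ) ≤
        A * L ^ (-p) * r ^ (-p) * ((r / t) ^ (1 / 2 : ℝ) * (r - t) ^ (p - σ - 1)) := by
  obtain ⟨K, hK0, hK⟩ := exists_lipschitz_smoothTransition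
  refine ⟨(K * (2 * p)) ^ p, by positivity, fun L r t hL ht htr => ?_⟩
  have hp0 : 0 < p := by linarith
  have hr : 0 < r := ht.trans htr
  have hrt : 0 < r - t := sub_pos.2 htr
  have h1 : |logCutoff L r - logCutoff L t| ≤
      K * (2 * p) * L⁻¹ * r⁻¹ * (r / t) ^ (1 / (2 * p)) * (r - t) := by
    rw [logCutoff_of_pos L hr, logCutoff_of_pos L ht]
    refine (hK _ _).trans ?_
    have hlog : 0 ≤ Real.log r - Real.log t := sub_nonneg.2 (Real.log_le_log ht htr.le)
    -- With a = 1/(2p), the p-th power has singularity t^(-1/2), which is integrable.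
    have h2 := log_div_le (a := 1 / (2 * p)) (by positivity)
      (by rw [div_le_one (by positivity)]; linarith) ht htr
    rw [add_sub_add_left_eq_sub, ← sub_div, abs_of_nonneg (by positivity)]
    calc K * ((Real.log r - Real.log t) / L)
        ≤ K * ((r - t) / r * (r / t) ^ (1 / (2 * p)) / (1 / (2 * p)) / L) := by gcongr
      _ = _ := by field_simp
  have h3 : ((r / t) ^ (1 / (2 * p))) ^ p = (r / t) ^ (1 / 2 : ℝ) := by
    rw [← Real.rpow_mul (by positivity)]
    congr 1
    field_simp
  rw [abs_of_pos hrt]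
  calc _ ≤ (K * (2 * p) * L⁻¹ * r⁻¹ * (r / t) ^ (1 / (2 * p)) * (r - t)) ^ p /
        (r - t) ^ (1 + σ) := by gcongr
    _ = _ := by
        rw [Real.mul_rpow (by positivity) hrt.le, Real.mul_rpow (by positivity) (by positivity),
          Real.mul_rpow (by positivity) (by positivity),
          Real.mul_rpow (by positivity) (by positivity), h3, Real.inv_rpow hL.le,
          Real.inv_rpow hr.le, ← Real.rpow_neg hL.le, ← Real.rpow_neg hr.le,
          show p - σ - 1 = p - (1 + σ) by ring, Real.rpow_sub hrt]
        ring

/-- By symmetry only t < r matters. The pointwise bound L^(-p) r^(-p) times the Beta-type integral,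
of order r^(p-σ), leaves L^(-p) r^(-σ); for r ≤ e^(-2L) both cutoff values vanish. -/
lemma exists_energy_logCutoff_le {p σ : ℝ} (hp : 1 ≤ p) (hσ : σ < p) : ∃ A : ℝ, 0 ≤ A ∧
    ∀ L : ℝ, 0 < L → energy p (1 + σ) (Set.Ioo (0 : ℝ) 2) (logCutoff L) ≤
      ENNReal.ofReal (A * L ^ (-p)) *
        ∫⁻ r in Set.Ioo (Real.exp (-(2 * L))) 2, ENNReal.ofReal (r ^ (-σ)) := by
  obtain ⟨A, hA0, hA⟩ := exists_logCutoff_sub_rpow_le (σ := σ) hp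
  obtain ⟨B, hB0, hB⟩ := exists_lintegral_beta_le (sub_pos.2 hσ)
  refine ⟨2 * A * B, by positivity, fun L hL => ?_⟩
  refine (energy_Ioo_le_two_mul hp (contDiff_logCutoff hL).continuous.measurable).trans ?_
  set ε := Real.exp (-(2 * L)) with hε
  have hε0 : 0 < ε := Real.exp_pos _
  have hin : ∀ r ∈ Set.Ioo (0 : ℝ) 2, ∫⁻ t in Set.Ioo 0 r,
      ENNReal.ofReal (|logCutoff L r - logCutoff L t| ^ p / |r - t| ^ (1 + σ)) ≤
      (Set.Ioi ε).indicator (fun r => ENNReal.ofReal (A * B * L ^ (-p)) *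
        ENNReal.ofReal (r ^ (-σ))) r := by
    rintro r ⟨hr, -⟩
    by_cases hrε : ε < r
    · rw [Set.indicator_of_mem (Set.mem_Ioi.2 hrε)]
      calc _ ≤ ∫⁻ t in Set.Ioo 0 r, ENNReal.ofReal (A * L ^ (-p) * r ^ (-p)) *
            ENNReal.ofReal ((r / t) ^ (1 / 2 : ℝ) * (r - t) ^ (p - σ - 1)) := by
            refine setLIntegral_mono' measurableSet_Ioo fun t ht => ?_
            rw [← ENNReal.ofReal_mul (by positivity)]
            exact ENNReal.ofReal_le_ofReal (hA L r t hL ht.1 ht.2)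
        _ ≤ ENNReal.ofReal (A * L ^ (-p) * r ^ (-p)) * ENNReal.ofReal (B * r ^ (p - σ)) := by
            rw [lintegral_const_mul' _ _ ENNReal.ofReal_ne_top]
            exact mul_le_mul_right (hB r hr) _
        _ = _ := by
            rw [← ENNReal.ofReal_mul (by positivity), ← ENNReal.ofReal_mul (by positivity)]
            congr 1
            rw [show -σ = -p + (p - σ) by ring, Real.rpow_add hr]
            ring
    · rw [Set.indicator_of_notMem (by simpa using hrε)]
      rw [not_lt] at hrε
      refine le_of_eq (setLIntegral_eq_zero measurableSet_Ioo fun t ht => ?_)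
      rw [logCutoff_eq_zero hL hrε, logCutoff_eq_zero hL (ht.2.le.trans hrε)]
      simp [Real.zero_rpow (by linarith : p ≠ 0)]
  have hset : Set.Ioi ε ∩ Set.Ioo (0 : ℝ) 2 = Set.Ioo ε 2 := by
    ext r
    simp only [Set.mem_inter_iff, Set.mem_Ioi, Set.mem_Ioo]
    constructor
    · rintro ⟨h1, h2, h3⟩
      exact ⟨h1, h3⟩
    · rintro ⟨h1, h2⟩
      exact ⟨h1, hε0.trans h1, h2⟩
  calc _ ≤ 2 * ∫⁻ r in Set.Ioo (0 : ℝ) 2, (Set.Ioi ε).indicator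
        (fun r => ENNReal.ofReal (A * B * L ^ (-p)) * ENNReal.ofReal (r ^ (-σ))) r :=
        mul_le_mul_right (setLIntegral_mono' measurableSet_Ioo hin) _
    _ = _ := by
        rw [lintegral_indicator measurableSet_Ioi, Measure.restrict_restrict measurableSet_Ioi,
          hset, lintegral_const_mul' _ _ ENNReal.ofReal_ne_top, ← mul_assoc,
          ← ENNReal.ofReal_ofNat 2, ← ENNReal.ofReal_mul (by norm_num)]
        ring_nf

/-- The growth exponent γ must stay below p to be beaten by L^(-p). For σ < 1 the integral is
bounded and γ = 0. For σ = 1 it is log 2 + 2L ≤ 3L, so γ = 1, and σ < p gives 1 < p. -/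
lemma exists_lintegral_rpow_neg_le {p σ : ℝ} (hp : 1 ≤ p) (hσ1 : σ ≤ 1) (hσp : σ < p) :
    ∃ D γ : ℝ, 0 ≤ D ∧ γ < p ∧ ∀ L : ℝ, 1 ≤ L →
      ∫⁻ r in Set.Ioo (Real.exp (-(2 * L))) 2, ENNReal.ofReal (r ^ (-σ)) ≤
        ENNReal.ofReal (D * L ^ γ) := by
  rcases hσ1.lt_or_eq with h | rfl
  · refine ⟨2 ^ (1 - σ) / (1 - σ), 0, div_nonneg (by positivity) (by linarith), by linarith,
      fun L hL => ?_⟩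
    rw [Real.rpow_zero, mul_one, ← lintegral_Ioo_rpow (sub_pos.2 h) two_pos]
    refine (lintegral_mono_set (Set.Ioo_subset_Ioo_left (Real.exp_pos _).le)).trans_eq ?_
    simp only [sub_sub_cancel_left]
  · refine ⟨3, 1, by norm_num, hσp, fun L hL => ?_⟩
    have hε := Real.exp_pos (-(2 * L))
    have hε2 : Real.exp (-(2 * L)) ≤ 2 := by
      have : Real.exp (-(2 * L)) ≤ 1 := Real.exp_le_one_iff.2 (by linarith)
      linarith
    have h0 : (0 : ℝ) ∉ Set.uIcc (Real.exp (-(2 * L))) 2 := by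
      rw [Set.uIcc_of_le hε2]
      exact fun h => not_lt.2 h.1 hε
    have hi : IntervalIntegrable (fun r : ℝ => r⁻¹) volume (Real.exp (-(2 * L))) 2 :=
      intervalIntegral.intervalIntegrable_inv (fun x hx h => h0 (h ▸ hx)) continuousOn_id
    have hv := integral_inv h0
    rw [intervalIntegral.integral_of_le hε2, integral_Ioc_eq_integral_Ioo,
      Real.log_div two_ne_zero hε.ne', Real.log_exp] at hv
    rw [intervalIntegrable_iff_integrableOn_Ioo_of_le hε2] at hi
    simp_rw [Real.rpow_neg_one]
    rw [← ofReal_integral_eq_lintegral_ofReal hi, hv, Real.rpow_one]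
    · refine ENNReal.ofReal_le_ofReal ?_
      have := Real.log_two_lt_d9
      linarith
    · filter_upwards [ae_restrict_mem measurableSet_Ioo] with t ht
      have : 0 < t := hε.trans ht.1
      positivity

/-! ### Test functions approximating the constant `1` -/

lemma energy_comp_add_one {p α : ℝ} (v : ℝ → ℝ) :
    energy p α (Set.Ioo (-1 : ℝ) 1) (fun x => v (x + 1)) = energy p α (Set.Ioo (0 : ℝ) 2) v := by
  have hshift : ∀ f : ℝ → ℝ≥0∞, ∫⁻ x in Set.Ioo (-1 : ℝ) 1, f (x + 1) =
      ∫⁻ x in Set.Ioo (0 : ℝ) 2, f x := by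
    intro f
    rw [← lintegral_indicator measurableSet_Ioo, ← lintegral_indicator measurableSet_Ioo,
      ← lintegral_add_right_eq_self ((Set.Ioo 0 2).indicator f) 1]
    refine lintegral_congr fun x => ?_
    have : x + 1 ∈ Set.Ioo (0 : ℝ) 2 ↔ x ∈ Set.Ioo (-1 : ℝ) 1 := by
      simp only [Set.mem_Ioo]
      constructor <;> rintro ⟨h1, h2⟩ <;> constructor <;> linarith
    by_cases h : x ∈ Set.Ioo (-1 : ℝ) 1
    · rw [Set.indicator_of_mem h, Set.indicator_of_mem (this.2 h)]
    · rw [Set.indicator_of_notMem h, Set.indicator_of_notMem (fun h' => h (this.1 h'))]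
  unfold energy
  rw [← hshift]
  refine lintegral_congr fun x => ?_
  rw [← hshift]
  refine lintegral_congr fun y => ?_
  rw [add_sub_add_right_eq_sub]

lemma energy_comp_neg {p α : ℝ} (v : ℝ → ℝ) :
    energy p α (Set.Ioo (-1 : ℝ) 1) (fun x => v (-x)) = energy p α (Set.Ioo (-1 : ℝ) 1) v := by
  have hrefl : ∀ f : ℝ → ℝ≥0∞, ∫⁻ x in Set.Ioo (-1 : ℝ) 1, f (-x) =
      ∫⁻ x in Set.Ioo (-1 : ℝ) 1, f x := by
    intro f
    rw [← lintegral_indicator measurableSet_Ioo, ← lintegral_indicator measurableSet_Ioo,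
      ← lintegral_neg_eq_self ((Set.Ioo (-1) 1).indicator f)]
    refine lintegral_congr fun x => ?_
    have : -x ∈ Set.Ioo (-1 : ℝ) 1 ↔ x ∈ Set.Ioo (-1 : ℝ) 1 := by
      simp only [Set.mem_Ioo]
      constructor <;> rintro ⟨h1, h2⟩ <;> constructor <;> linarith
    by_cases h : x ∈ Set.Ioo (-1 : ℝ) 1
    · rw [Set.indicator_of_mem h, Set.indicator_of_mem (this.2 h)]
    · rw [Set.indicator_of_notMem h, Set.indicator_of_notMem (fun h' => h (this.1 h'))]
  unfold energy
  rw [← hrefl]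
  refine lintegral_congr fun x => ?_
  rw [← hrefl]
  refine lintegral_congr fun y => ?_
  rw [neg_sub_neg, norm_sub_rev]
  simp only [neg_neg]

/-- A test function on `(-1,1)` equal to `1` away from logarithmically small neighbourhoods of the
endpoints. -/
noncomputable def logTest (L x : ℝ) : ℝ := logCutoff L (x + 1) * logCutoff L (-x + 1)

lemma isTest_logTest {L : ℝ} (hL : 0 < L) : IsTest (Set.Ioo (-1 : ℝ) 1) (logTest L) := by
  have hε := Real.exp_pos (-(2 * L))
  have hsub : Function.support (logTest L) ⊆
      Set.Icc (-1 + Real.exp (-(2 * L))) (1 - Real.exp (-(2 * L))) := by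
    intro x hx
    constructor
    · by_contra h
      exact left_ne_zero_of_mul hx (logCutoff_eq_zero hL (by linarith))
    · by_contra h
      exact right_ne_zero_of_mul hx (logCutoff_eq_zero hL (by linarith))
  have hc := contDiff_logCutoff hL
  refine ⟨(hc.comp (by fun_prop)).mul (hc.comp (by fun_prop)),
    HasCompactSupport.of_support_subset_isCompact isCompact_Icc hsub,
    (closure_minimal hsub isClosed_Icc).trans (Set.Icc_subset_Ioo ?_ ?_)⟩ <;> linarith

lemma energy_logTest_le {p α L : ℝ} (hp : 1 ≤ p) (hL : 0 < L) :
    energy p α (Set.Ioo (-1 : ℝ) 1) (logTest L) ≤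
      ENNReal.ofReal (2 * (1 / 2) ^ (1 - p)) * energy p α (Set.Ioo (0 : ℝ) 2) (logCutoff L) := by
  have hm := (contDiff_logCutoff hL).continuous.measurable
  have h := energy_le_weighted (p := p) (α := α) (θ := 1 / 2) (Ω := Set.Ioo (-1 : ℝ) 1)
    (u := logTest L) (v := fun x => logCutoff L (x + 1)) (w := fun x => logCutoff L (-x + 1)) hp
    (by norm_num) (by norm_num) (by fun_prop) fun x y => ?_
  · rw [energy_comp_neg (fun x => logCutoff L (x + 1)), energy_comp_add_one] at h
    refine h.trans_eq ?_
    rw [show (1 : ℝ) - 1 / 2 = 1 / 2 by norm_num, ENNReal.ofReal_mul (by norm_num),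
      ENNReal.ofReal_ofNat]
    ring
  · have e : logTest L x - logTest L y =
        (logCutoff L (x + 1) - logCutoff L (y + 1)) * logCutoff L (-x + 1) +
        logCutoff L (y + 1) * (logCutoff L (-x + 1) - logCutoff L (-y + 1)) := by
      unfold logTest
      ring
    rw [e]
    refine (abs_add_le _ _).trans ?_
    rw [abs_mul, abs_mul, abs_of_nonneg (logCutoff_nonneg L (-x + 1)),
      abs_of_nonneg (logCutoff_nonneg L (y + 1))]
    exact add_le_add (mul_le_of_le_one_right (abs_nonneg _) (logCutoff_le_one _ _))
      (mul_le_of_le_one_left (abs_nonneg _) (logCutoff_le_one _ _))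

lemma one_le_lpIntegral_logTest {p L : ℝ} (hL : 1 ≤ L) :
    1 ≤ lpIntegral p (Set.Ioo (-1 : ℝ) 1) (logTest L) := by
  have hL0 : 0 < L := by linarith
  have hexp : Real.exp (-L) ≤ 1 / 2 := by
    have h1 : Real.exp (-L) ≤ Real.exp (-1) := Real.exp_le_exp.2 (by linarith)
    have h2 := Real.exp_neg_one_lt_d9
    linarith
  calc (1 : ℝ≥0∞) = ∫⁻ x in Set.Ioo (-(1 / 2) : ℝ) (1 / 2), 1 := by
        rw [setLIntegral_one, Real.volume_Ioo]
        norm_num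
    _ = ∫⁻ x in Set.Ioo (-(1 / 2) : ℝ) (1 / 2), ENNReal.ofReal (|logTest L x| ^ p) := by
        refine setLIntegral_congr_fun measurableSet_Ioo fun x hx => ?_
        have h1 : logTest L x = 1 := by
          unfold logTest
          rw [logCutoff_eq_one hL0 (by linarith [hx.1]), logCutoff_eq_one hL0 (by linarith [hx.2]),
            mul_one]
        simp [h1]
    _ ≤ _ := lintegral_mono_set (Set.Ioo_subset_Ioo (by norm_num) (by norm_num))

/-- The functions `logTest L` have L^p mass at least 1 and energy O(L^(γ-p)), which tends to 0. At
the critical value sp = 1 the logarithmic scale is what gives this decay. -/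
lemma regionalConst_Ioo_eq_zero {s p : ℝ} (hs1 : s < 1) (hp : 1 ≤ p) (hsp : s ≤ 1 / p) :
    regionalConst s p (Set.Ioo (-1 : ℝ) 1) = 0 := by
  have hσ1 : s * p ≤ 1 := by rwa [le_div_iff₀ (by linarith)] at hsp
  have hσp : s * p < p := by nlinarith
  obtain ⟨A, hA0, hA⟩ := exists_energy_logCutoff_le hp hσp
  obtain ⟨D, γ, hD0, hγ, hD⟩ := exists_lintegral_rpow_neg_le hp hσ1 hσp
  set c : ℝ≥0∞ := ENNReal.ofReal (normConst 1 s p / 2) with hc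
  set b : ℝ≥0∞ := ENNReal.ofReal (2 * (1 / 2) ^ (1 - p)) with hb
  have hlim : Tendsto (fun L : ℝ => c * (b * ENNReal.ofReal (A * D * L ^ (-(p - γ))))) atTop
      (𝓝 0) := by
    have h1 : Tendsto (fun L : ℝ => A * D * L ^ (-(p - γ))) atTop (𝓝 0) := by
      simpa using (tendsto_rpow_neg_atTop (sub_pos.2 hγ)).const_mul (A * D)
    have h2 := ENNReal.Tendsto.const_mul (a := b) (ENNReal.tendsto_ofReal h1)
      (Or.inr ENNReal.ofReal_ne_top)
    have h3 := ENNReal.Tendsto.const_mul (a := c) h2 (Or.inr ENNReal.ofReal_ne_top)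
    simpa using h3
  refine le_antisymm (ge_of_tendsto hlim ?_) zero_le
  filter_upwards [eventually_ge_atTop 1] with L hL
  have hL0 : 0 < L := by linarith
  have h := regionalConst_mul_lpIntegral_le (s := s) hp (isTest_logTest hL0)
  rw [seminorm_rpow hp, Module.finrank_self, Nat.cast_one] at h
  calc _ ≤ regionalConst s p (Set.Ioo (-1 : ℝ) 1) *
        lpIntegral p (Set.Ioo (-1 : ℝ) 1) (logTest L) :=
        le_mul_of_one_le_right' (one_le_lpIntegral_logTest hL)
    _ ≤ _ := h
    _ ≤ c * (b * (ENNReal.ofReal (A * L ^ (-p)) * ENNReal.ofReal (D * L ^ γ))) := by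
        refine mul_le_mul_right ((energy_logTest_le hp hL0).trans (mul_le_mul_right ?_ _)) _
        exact (hA L hL0).trans (mul_le_mul_right (hD L hL) _)
    _ = _ := by
        rw [← ENNReal.ofReal_mul (by positivity), show -(p - γ) = -p + γ by ring,
          Real.rpow_add hL0]
        ring_nf

end FracPoincare

theorem theorem1p4 (n : ℕ) (hn : 1 ≤ n) (s p : ℝ) (hs0 : 0 < s) (hs1 : s < 1) (hp : 1 ≤ p) :
    (s ≤ 1 / p →
      FracPoincare.regionalConst s p (FracPoincare.strip n hn) =
          FracPoincare.regionalConst s p (Set.Ioo (-1 : ℝ) 1) ∧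
        FracPoincare.regionalConst s p (Set.Ioo (-1 : ℝ) 1) = 0) ∧
    (FracPoincare.regionalConst s p (FracPoincare.strip n hn) =
        FracPoincare.regionalConst s p (Set.Ioo (-1 : ℝ) 1) ∧
      FracPoincare.regionalConst s p (Set.Ioo (-1 : ℝ) 1) < ⊤ ∧
      (1 / p < s → 0 < FracPoincare.regionalConst s p (FracPoincare.strip n hn))) := by
  obtain ⟨m, rfl⟩ : ∃ m, n = m + 1 := ⟨n - 1, by omega⟩
  have heq := FracPoincare.regionalConst_strip_eq m (hn := hn) hs0 hs1 hp
  exact ⟨fun h => ⟨heq, FracPoincare.regionalConst_Ioo_eq_zero hs1 hp h⟩, heq,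
    (FracPoincare.regionalConst_Ioo_ne_top hs1 hp).lt_top,
    fun h => heq ▸ FracPoincare.regionalConst_Ioo_pos hs0 hs1 hp h⟩
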